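/- **Theorem.** Let $\Sigma,\Gamma,\Phi$ be finite alphabets, let $\mathbb{D}=\{w\in\mathbb{C}:|w|\le 1\}$ be the closed unit disk, and let $\mu$ be a probability distribution on $\Sigma\times\Gamma\times\Phi$ that is *pairwise-connected*: the bipartite graph with vertex set the disjoint union $\Sigma\sqcup\Gamma$, in which $x\in\Sigma$ and $y\in\Gamma$ are adjacent if and only if $(x,y,z)\in\mathsf{supp}(\mu)$ for some $z\in\Phi$, is connected, and the bipartite graphs defined in the same way on $\Gamma\sqcup\Phi$ and on $\Sigma\sqcup\Phi$ are connected. Let $T:\mathsf{supp}(\mu)\to\mathbb{D}$ be *nonembeddable over* $\mathbb{D}$, i.e. there are no functions $A:\Sigma\to\mathbb{D}$, $B:\Gamma\to\mathbb{D}$, $C:\Phi\to\mathbb{D}$ with $A(x)B(y)C(z)T(x,y,z)=1$ for all $(x,y,z)\in\mathsf{supp}(\mu)$. Then there is a constant $c=c(T,\mu)>0$ such that for all $n$ and all functions $F:\Sigma^n\to\mathbb{D}$, $G:\Gamma^n\to\mathbb{D}$, $H:\Phi^n\to\mathbb{D}$, $$\left|\mathbb{E}_{(x,y,z)\sim\mu^{\otimes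 n}}\left[F(x)\,G(y)\,H(z)\prod_{i=1}^n T(x_i,y_i,z_i)\right]\right|\le 2^{-cn}.$$ -/

import Mathlib

/-- The product distribution `μ^{⊗ n}` on words of length `n` over a finite alphabet. -/
noncomputable def tensorPower {α : Type*} [Fintype α] (μ : PMF α) (n : ℕ) : PMF (Fin n → α) :=
  PMF.ofFintype (fun w => ∏ i, μ (w i)) (by
    have h : ∑ a, μ a = 1 := by
      rw [← tsum_fintype (L := .unconditional α)]
      exact μ.tsum_coe
    rw [← Fintype.piFinset_univ, ← Finset.prod_univ_sum]
    simp [h])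

/-- The expectation of a complex-valued function under a distribution on a finite set. -/
noncomputable def expectation {α : Type*} [Fintype α] (ν : PMF α) (f : α → ℂ) : ℂ :=
  ∑ a, ((ν a).toReal : ℂ) * f a

/-- The bipartite graph on the disjoint union of `α` and `β` whose edges are the pairs
`(a, b)` with `R a b`. -/
def bipartiteGraph {α β : Type*} (R : α → β → Prop) : SimpleGraph (α ⊕ β) :=
  SimpleGraph.fromRel (fun u v => ∃ a b, u = Sum.inl a ∧ v = Sum.inr b ∧ R a b)

/-- `μ` is pairwise-connected: for each of the three pairs of coordinates, the bipartite graph on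
the two alphabets given by the support of the corresponding marginal is connected. -/
def PairwiseConnected {S G P : Type*} (μ : PMF (S × G × P)) : Prop :=
  (bipartiteGraph fun x y => ∃ z, (x, y, z) ∈ μ.support).Connected ∧
  (bipartiteGraph fun y z => ∃ x, (x, y, z) ∈ μ.support).Connected ∧
  (bipartiteGraph fun x z => ∃ y, (x, y, z) ∈ μ.support).Connected

/-- `T` (of which only the values on the support of `μ` matter) is nonembeddable over the closed
unit disk. -/
def Nonembeddable {S G P : Type*} (μ : PMF (S × G × P)) (T : S × G × P → ℂ) : Prop :=
  ¬ ∃ (A : S → ℂ) (B : G → ℂ) (C : P → ℂ),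
    (∀ x, ‖A x‖ ≤ 1) ∧ (∀ y, ‖B y‖ ≤ 1) ∧ (∀ z, ‖C z‖ ≤ 1) ∧
    ∀ x y z, (x, y, z) ∈ μ.support → A x * B y * C z * T (x, y, z) = 1

/-! Every form met in the proof is a sum over words of a product weight `w` times bounded functions.
A mass bounding `|w|` and of total at most `1` is carried along with it. If some entry of the weight
is strictly smaller than its mass, the ℓ¹ norm of `w` is below `1` and its `n`-th power already
bounds the form. Thus cancellation at any stage gives exponential decay, and absence of cancellation
forces identities between the phases of all contributing terms (`Aligned`).

Cauchy–Schwarz replaces a kernel `K` by `K K*`, normalised so that marginals do not grow. For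
bilinear forms, repeated squaring gives a dichotomy (`bilinear_decay_or_phase`): either there is
decay, or the phases in each column come from a single function `α` of the row.

To make a trilinear form bilinear, each of `F`, `G`, `H` is replaced by a dual function, an average
of products `f(plus letters) g(minus letters)`. Connectivity through the other two alphabets makes
the averaging kernel rich enough to contain registers: a word `b` is stored in the plus letters, and
any single letter `b j` can be read off in such a way that the minus letters do not depend on it
(`exists_register_dual`). In the resulting bilinear form, the row records three words of registers,
the column forgets the three letters being read, and the phase of the entry is the value of `T` at
those letters. Without decay, `α` therefore changes by a quotient of values of `T` whenever a
support triple of letters is replaced by another (`decay_or_replaces`).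

Such an `α` is invariant under permuting any one of its words, because two replacements perform a
transposition. So `T` has the same product over two families of support triples whose coordinates
agree up to permutation (`Replaces.prod_eq`). This says that `T` kills all integral relations
between support triples. The circle is divisible, hence `T` extends to a product of functions of the
three coordinates, which contradicts nonembeddability. -/

/-! ### Sums over words and the Cauchy–Schwarz inequality -/

/-- The sum over words of length `n` of a product weight times a test function. -/
noncomputable def wordSum {Ω : Type*} [Fintype Ω] (n : ℕ) (w : Ω → ℂ)
    (φ : (Fin n → Ω) → ℂ) : ℂ :=
  ∑ ω, (∏ i, w (ω i)) * φ ω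

/-- The kernel `K K*`, normalised by the weights `m`. -/
noncomputable def gram {X Y : Type*} [Fintype Y] (m : Y → ℝ) (K : X → Y → ℂ) : X → X → ℂ :=
  fun x x' => ∑ y, K x y * star (K x' y) / (m y : ℂ)

/-- The kernel `V Vᵀ`, normalised by the weights `m`. -/
noncomputable def gramMass {X Y : Type*} [Fintype Y] (m : Y → ℝ) (V : X → Y → ℝ) : X → X → ℝ :=
  fun x x' => ∑ y, V x y * V x' y / m y

theorem sum_arrow_prod {A B : Type*} [Fintype A] [Fintype B] {M : Type*} [AddCommMonoid M]
    (n : ℕ) (φ : (Fin n → A × B) → M) :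
    ∑ ω, φ ω = ∑ a : Fin n → A, ∑ b : Fin n → B, φ (fun i => (a i, b i)) := by
  rw [← Fintype.sum_prod_type']
  exact Fintype.sum_equiv (Equiv.arrowProdEquivProdArrow (Fin n) _ _) _ _ (fun _ => rfl)

theorem prod_sum_words {A R : Type*} [Fintype A] [CommSemiring R] (n : ℕ) (F : Fin n → A → R) :
    ∏ i, ∑ a, F i a = ∑ a : Fin n → A, ∏ i, F i (a i) := by
  classical
  rw [Finset.prod_univ_sum, Fintype.piFinset_univ]

theorem wordSum_equiv {Ω Ω' : Type*} [Fintype Ω] [Fintype Ω'] (n : ℕ) (e : Ω' ≃ Ω) (w : Ω → ℂ)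
    (φ : (Fin n → Ω) → ℂ) :
    wordSum n w φ = wordSum n (fun ω => w (e ω)) (fun ω => φ (fun i => e (ω i))) :=
  (Fintype.sum_equiv (Equiv.arrowCongr (Equiv.refl _) e) _ _ (fun _ => rfl)).symm

/-- The trivial bound, and the source of all exponential decay: it is applied to weights of ℓ¹ norm
below `1`. -/
theorem norm_wordSum_le {Ω : Type*} [Fintype Ω] (n : ℕ) (w : Ω → ℂ)
    (φ : (Fin n → Ω) → ℂ) (hφ : ∀ ω, ‖φ ω‖ ≤ 1) :
    ‖wordSum n w φ‖ ≤ (∑ ω, ‖w ω‖) ^ n := by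
  have h : (∑ ω, ‖w ω‖) ^ n = ∑ ω : Fin n → Ω, ∏ i, ‖w (ω i)‖ := by
    rw [← prod_sum_words n (fun _ ω => ‖w ω‖)]
    simp
  rw [h]
  refine norm_sum_le_of_le _ fun ω _ => ?_
  rw [norm_mul, norm_prod]
  exact mul_le_of_le_one_right (by positivity) (hφ ω)

/-- The Cauchy–Schwarz inequality eliminating the bounded function `g`. -/
theorem sq_norm_wordSum_le {X Y : Type*} [Fintype X] [Fintype Y] (n : ℕ) (K : X → Y → ℂ)
    (m : Y → ℝ) (hm : ∀ y, 0 ≤ m y) (hm1 : ∑ y, m y ≤ 1) (hm0 : ∀ x y, m y = 0 → K x y = 0)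
    (f : (Fin n → X) → ℂ) (g : (Fin n → Y) → ℂ) (hg : ∀ y, ‖g y‖ ≤ 1) :
    ‖wordSum n (fun ω : X × Y => K ω.1 ω.2)
        (fun ω => f (fun i => (ω i).1) * g (fun i => (ω i).2))‖ ^ 2 ≤
      ‖wordSum n (fun ω : X × X => gram m K ω.1 ω.2)
        (fun ω => f (fun i => (ω i).1) * star (f (fun i => (ω i).2)))‖ := by
  set S : (Fin n → Y) → ℂ := fun y => ∑ x : Fin n → X, (∏ i, K (x i) (y i)) * f x with hS
  set M : (Fin n → Y) → ℝ := fun y => ∏ i, m (y i) with hM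
  have hMnn : ∀ y, 0 ≤ M y := fun y => Finset.prod_nonneg fun i _ => hm _
  have hMsum : ∑ y, M y ≤ 1 := by
    rw [hM, ← prod_sum_words n (fun _ y => m y)]
    exact Finset.prod_le_one (fun i _ => Finset.sum_nonneg fun y _ => hm y) (fun i _ => hm1)
  have hS0 : ∀ y, M y = 0 → S y = 0 := by
    intro y hy
    obtain ⟨i, -, hi⟩ := Finset.prod_eq_zero_iff.1 hy
    refine Finset.sum_eq_zero fun x _ => ?_
    rw [Finset.prod_eq_zero (Finset.mem_univ i) (hm0 _ _ hi), zero_mul]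
  have h1 : wordSum n (fun ω : X × Y => K ω.1 ω.2)
        (fun ω => f (fun i => (ω i).1) * g (fun i => (ω i).2)) = ∑ y, S y * g y := by
    rw [wordSum, sum_arrow_prod, Finset.sum_comm]
    refine Finset.sum_congr rfl fun y _ => ?_
    rw [hS, Finset.sum_mul]
    exact Finset.sum_congr rfl fun x _ => by ring
  have h2 : wordSum n (fun ω : X × X => gram m K ω.1 ω.2)
        (fun ω => f (fun i => (ω i).1) * star (f (fun i => (ω i).2))) =
      ((∑ y, ‖S y‖ ^ 2 / M y : ℝ) : ℂ) := by
    rw [wordSum, sum_arrow_prod]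
    simp only [gram]
    simp_rw [prod_sum_words n, Finset.sum_mul]
    push_cast
    have h3 : ∀ y, ((‖S y‖ : ℂ) ^ 2 / (M y : ℂ)) = ∑ x : Fin n → X, ∑ x' : Fin n → X,
        (∏ i, K (x i) (y i) * star (K (x' i) (y i)) / (m (y i) : ℂ)) * (f x * star (f x')) := by
      intro y
      rw [← Complex.mul_conj', hS, hM]
      simp only [map_sum, map_mul, map_prod]
      rw [Finset.sum_mul_sum, Finset.sum_div]
      refine Finset.sum_congr rfl fun x _ => ?_
      rw [Finset.sum_div]
      refine Finset.sum_congr rfl fun x' _ => ?_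
      simp only [Finset.prod_div_distrib, Finset.prod_mul_distrib]
      push_cast
      simp only [starRingEnd_apply]
      ring
    simp_rw [h3]
    calc _ = ∑ x : Fin n → X, ∑ y : Fin n → Y, ∑ x' : Fin n → X, _ :=
          Finset.sum_congr rfl fun x _ => Finset.sum_comm
      _ = _ := Finset.sum_comm
  rw [h1, h2, Complex.norm_real]
  refine le_trans ?_ (le_abs_self _)
  have h4 : ‖∑ y, S y * g y‖ ≤ ∑ y, ‖S y‖ := by
    refine norm_sum_le_of_le _ fun y _ => ?_
    rw [norm_mul]
    exact mul_le_of_le_one_right (norm_nonneg _) (hg y)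
  have hnn : ∀ y, 0 ≤ ‖S y‖ ^ 2 / M y := fun y => div_nonneg (by positivity) (hMnn y)
  calc ‖∑ y, S y * g y‖ ^ 2 ≤ (∑ y, ‖S y‖) ^ 2 := by gcongr
    _ ≤ (∑ y, M y) * ∑ y, ‖S y‖ ^ 2 / M y := by
        refine Finset.sum_sq_le_sum_mul_sum_of_sq_le_mul _ (fun y _ => hMnn y) (fun y _ => hnn y) ?_
        intro y _
        -- Division by a zero weight gives `0`, which is harmless because `S` vanishes there as
        -- well.
        by_cases h : M y = 0
        · simp [h, hS0 y h]
        · exact le_of_eq (by field_simp)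
    _ ≤ _ := mul_le_of_le_one_left (Finset.sum_nonneg fun y _ => hnn y) hMsum

/-- The push-forward of a weight along a map. -/
noncomputable def pushWeight {Ω Z M : Type*} [Fintype Ω] [DecidableEq Z] [AddCommMonoid M]
    (π : Ω → Z) (w : Ω → M) (z : Z) : M :=
  ∑ ω, if π ω = z then w ω else 0

theorem wordSum_push {Ω Z : Type*} [Fintype Ω] [Fintype Z] [DecidableEq Z] (n : ℕ) (π : Ω → Z)
    (w : Ω → ℂ) (ψ : (Fin n → Z) → ℂ) :
    wordSum n w (fun ω => ψ (fun i => π (ω i))) = wordSum n (pushWeight π w) ψ := by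
  simp only [wordSum, pushWeight]
  simp_rw [prod_sum_words n, Finset.sum_mul]
  rw [Finset.sum_comm]
  refine Finset.sum_congr rfl fun ω _ => ?_
  rw [Finset.sum_eq_single (fun i => π (ω i))]
  · simp
  · intro z _ hz
    obtain ⟨i, hi⟩ := Function.ne_iff.1 hz
    rw [Finset.prod_eq_zero (Finset.mem_univ i), zero_mul]
    exact if_neg (fun h => hi h.symm)
  · simp

/-! ### Phases in the absence of cancellation -/

/-- The complex weight `k` of mass `v` has a part of phase `θ`: if there is no cancellation in `k`,
then all of `k` has phase `θ`. -/
def Aligned (k : ℂ) (v : ℝ) (θ : ℂ) : Prop :=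
  0 < v ∧ (‖k‖ = v → k = v * θ)

/-- Equality in the triangle inequality forces every summand to have full modulus and the common
phase, so a single summand of known phase determines the phase of the sum. -/
theorem Aligned.sum {ι : Type*} {s : Finset ι} {k : ι → ℂ} {v : ι → ℝ} {θ : ℂ}
    (hkv : ∀ i ∈ s, ‖k i‖ ≤ v i) {j : ι} (hj : j ∈ s) (h : Aligned (k j) (v j) θ) :
    Aligned (∑ i ∈ s, k i) (∑ i ∈ s, v i) θ := by
  have hv : ∀ i ∈ s, 0 ≤ v i := fun i hi => (norm_nonneg _).trans (hkv i hi)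
  have hpos : 0 < ∑ i ∈ s, v i := Finset.sum_pos' hv ⟨j, hj, h.1⟩
  refine ⟨hpos, fun heq => ?_⟩
  set t := ∑ i ∈ s, k i with ht
  -- The phase of the total. After rotation by `star u`, the real parts are bounded by the masses
  -- and have the same sum, so they agree termwise.
  set u : ℂ := t / ((∑ i ∈ s, v i : ℝ) : ℂ) with hu
  have hne : ((∑ i ∈ s, v i : ℝ) : ℂ) ≠ 0 := by exact_mod_cast hpos.ne'
  have htu : t = ((∑ i ∈ s, v i : ℝ) : ℂ) * u := by rw [hu]; field_simp
  have hun : ‖u‖ = 1 := by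
    rw [hu, norm_div, heq, Complex.norm_real, Real.norm_of_nonneg hpos.le, div_self hpos.ne']
  have huu : u * star u = 1 := by
    rw [← starRingEnd_apply, Complex.mul_conj', hun]; simp
  have hle : ∀ i ∈ s, (k i * star u).re ≤ v i := fun i hi => by
    refine (Complex.re_le_norm _).trans ?_
    rw [norm_mul, norm_star, hun, mul_one]
    exact hkv i hi
  have hsum : ∑ i ∈ s, (k i * star u).re = ∑ i ∈ s, v i := by
    rw [← Complex.re_sum, ← Finset.sum_mul, ← ht, htu, mul_assoc, huu, mul_one, Complex.ofReal_re]
  have hj1 : (k j * star u).re = v j := (Finset.sum_eq_sum_iff_of_le hle).1 hsum j hj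
  have hj2 : ‖k j‖ = v j := by
    refine le_antisymm (hkv j hj) ?_
    rw [← hj1]
    refine (Complex.re_le_norm _).trans ?_
    rw [norm_mul, norm_star, hun, mul_one]
  have hj3 : k j * star u = v j := by
    have h1 : ‖k j * star u‖ = (k j * star u).re := by
      rw [hj1, norm_mul, norm_star, hun, mul_one, hj2]
    have h2 : (k j * star u).im = 0 := by
      rw [← Complex.abs_re_eq_norm, h1, abs_of_nonneg]
      rw [← h1]; exact norm_nonneg _
    apply Complex.ext
    · rw [hj1, Complex.ofReal_re]
    · rw [Complex.ofReal_im, h2]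
  have hj4 : k j = v j * u := by
    rw [← hj3, mul_assoc, mul_comm (star u), huu, mul_one]
  have hθ : u = θ := by
    have := hj4.symm.trans (h.2 hj2)
    exact mul_left_cancel₀ (by exact_mod_cast h.1.ne') this
  rw [htu, hθ]

theorem Aligned.mul {k k' : ℂ} {v v' : ℝ} {θ θ' : ℂ} (hk : ‖k‖ ≤ v) (hk' : ‖k'‖ ≤ v')
    (h : Aligned k v θ) (h' : Aligned k' v' θ') : Aligned (k * k') (v * v') (θ * θ') := by
  refine ⟨mul_pos h.1 h'.1, fun heq => ?_⟩
  rw [norm_mul] at heq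
  have h1 : ‖k‖ = v := by
    refine le_antisymm hk (not_lt.1 fun hlt => ?_)
    have : ‖k‖ * ‖k'‖ < v * v' := by
      calc ‖k‖ * ‖k'‖ ≤ ‖k‖ * v' := by gcongr
        _ < v * v' := mul_lt_mul_of_pos_right hlt h'.1
    exact this.ne heq
  have h2 : ‖k'‖ = v' := by
    rw [h1] at heq
    exact mul_left_cancel₀ h.1.ne' heq
  rw [h.2 h1, h'.2 h2]
  push_cast
  ring

theorem Aligned.star {k : ℂ} {v : ℝ} {θ : ℂ} (h : Aligned k v θ) : Aligned (star k) v (star θ) := by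
  refine ⟨h.1, fun heq => ?_⟩
  rw [norm_star] at heq
  conv_lhs => rw [h.2 heq]
  simp [mul_comm]

theorem Aligned.div {k : ℂ} {v : ℝ} {θ : ℂ} (h : Aligned k v θ) {m : ℝ} (hm : 0 < m) :
    Aligned (k / m) (v / m) θ := by
  refine ⟨div_pos h.1 hm, fun heq => ?_⟩
  rw [norm_div, Complex.norm_real, Real.norm_of_nonneg hm.le, div_left_inj' hm.ne'] at heq
  conv_lhs => rw [h.2 heq]
  push_cast
  ring

theorem Aligned.mul_star_self {k : ℂ} {v : ℝ} (hv : 0 < v) :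
    Aligned (k * Star.star k) (v * v) 1 := by
  refine ⟨mul_pos hv hv, fun heq => ?_⟩
  rw [norm_mul, norm_star] at heq
  rw [← starRingEnd_apply, Complex.mul_conj', ← Complex.ofReal_pow, pow_two, heq]
  simp

theorem Aligned.unique {k : ℂ} {v : ℝ} {θ θ' : ℂ} (h : Aligned k v θ) (h' : Aligned k v θ')
    (hk : ‖k‖ = v) : θ = θ' :=
  mul_left_cancel₀ (by exact_mod_cast h.1.ne') ((h.2 hk).symm.trans (h'.2 hk))

/-! ### One squaring step -/

section Gram

variable {X Y : Type*} {K : X → Y → ℂ} {V : X → Y → ℝ} {m : Y → ℝ}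

theorem mass_le [Fintype X] (hK : ∀ x y, ‖K x y‖ ≤ V x y) (hm : ∀ y, ∑ x, V x y ≤ m y) (x : X)
    (y : Y) :
    V x y ≤ m y :=
  (Finset.single_le_sum (f := fun x => V x y) (fun x _ => (norm_nonneg _).trans (hK x y))
    (Finset.mem_univ x)).trans (hm y)

theorem mass_nonneg (hK : ∀ x y, ‖K x y‖ ≤ V x y) (x : X) (y : Y) : 0 ≤ V x y :=
  (norm_nonneg _).trans (hK x y)

theorem weight_nonneg [Fintype X] (hK : ∀ x y, ‖K x y‖ ≤ V x y) (hm : ∀ y, ∑ x, V x y ≤ m y)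
    (y : Y) :
    0 ≤ m y :=
  (Finset.sum_nonneg fun x _ => mass_nonneg hK x y).trans (hm y)

theorem norm_gram_term_le [Fintype X] (hK : ∀ x y, ‖K x y‖ ≤ V x y) (hm : ∀ y, ∑ x, V x y ≤ m y)
    (x x' : X) (y : Y) : ‖K x y * star (K x' y) / (m y : ℂ)‖ ≤ V x y * V x' y / m y := by
  have := weight_nonneg hK hm y
  have := mass_nonneg hK x y
  rw [norm_div, norm_mul, norm_star, Complex.norm_real, Real.norm_of_nonneg (weight_nonneg hK hm y)]
  gcongr
  · exact hK x y
  · exact hK x' y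

theorem norm_gram_le [Fintype X] [Fintype Y] (hK : ∀ x y, ‖K x y‖ ≤ V x y)
    (hm : ∀ y, ∑ x, V x y ≤ m y) (x x' : X) :
    ‖gram m K x x'‖ ≤ gramMass m V x x' :=
  norm_sum_le_of_le _ fun y _ => norm_gram_term_le hK hm x x' y

theorem gramMass_comm [Fintype Y] (x x' : X) : gramMass m V x x' = gramMass m V x' x :=
  Finset.sum_congr rfl fun y _ => by rw [mul_comm (V x y)]

/-- The weights `m` dominate the column sums, so squaring does not increase the row sums; this is
what allows squaring to be iterated. -/
theorem sum_gramMass_le [Fintype X] [Fintype Y] (hK : ∀ x y, ‖K x y‖ ≤ V x y)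
    (hm : ∀ y, ∑ x, V x y ≤ m y) (x : X) :
    ∑ x', gramMass m V x x' ≤ ∑ y, V x y := by
  unfold gramMass
  rw [Finset.sum_comm]
  refine Finset.sum_le_sum fun y _ => ?_
  rw [← Finset.sum_div, ← Finset.mul_sum]
  refine div_le_of_le_mul₀ (weight_nonneg hK hm y) (mass_nonneg hK x y) ?_
  exact mul_le_mul_of_nonneg_left (hm y) (mass_nonneg hK x y)

theorem kernel_eq_zero [Fintype X] (hK : ∀ x y, ‖K x y‖ ≤ V x y) (hm : ∀ y, ∑ x, V x y ≤ m y)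
    (x : X) (y : Y)
    (h : m y = 0) : K x y = 0 := by
  have := (hK x y).trans (mass_le hK hm x y)
  rw [h] at this
  exact norm_le_zero_iff.1 this

/-- One common column `y` contributes a term of phase `θ * star θ'`, and by `Aligned.sum` one term
suffices. -/
theorem aligned_gram [Fintype X] [Fintype Y] (hK : ∀ x y, ‖K x y‖ ≤ V x y)
    (hm : ∀ y, ∑ x, V x y ≤ m y) {x x' : X} {y : Y}
    {θ θ' : ℂ} (h : Aligned (K x y) (V x y) θ) (h' : Aligned (K x' y) (V x' y) θ') :
    Aligned (gram m K x x') (gramMass m V x x') (θ * star θ') := by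
  refine Aligned.sum (fun y _ => norm_gram_term_le hK hm x x' y) (Finset.mem_univ y) ?_
  refine Aligned.div ?_ (h.1.trans_le (mass_le hK hm x y))
  exact h.mul (hK x y) (by rw [norm_star]; exact hK x' y) h'.star

/-- On the diagonal a phase meets its own conjugate, so positive mass is enough. -/
theorem aligned_gram_self [Fintype X] [Fintype Y] (hK : ∀ x y, ‖K x y‖ ≤ V x y)
    (hm : ∀ y, ∑ x, V x y ≤ m y) {x : X} {y : Y}
    (h : 0 < V x y) : Aligned (gram m K x x) (gramMass m V x x) 1 := by
  refine Aligned.sum (fun y _ => norm_gram_term_le hK hm x x y) (Finset.mem_univ y) ?_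
  exact (Aligned.mul_star_self h).div (h.trans_le (mass_le hK hm x y))

theorem gramMass_pos [Fintype X] [Fintype Y] (hK : ∀ x y, ‖K x y‖ ≤ V x y)
    (hm : ∀ y, ∑ x, V x y ≤ m y) {x x' : X} {y : Y}
    (h : 0 < V x y) (h' : 0 < V x' y) : 0 < gramMass m V x x' := by
  refine Finset.sum_pos' (fun y _ => (norm_nonneg _).trans (norm_gram_term_le hK hm x x' y))
    ⟨y, Finset.mem_univ y, ?_⟩
  exact div_pos (mul_pos h h') (h.trans_le (mass_le hK hm x y))

end Gram

/-! ### Repeated squaring and connectivity -/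

/-- Repeated squaring of a kernel. -/
noncomputable def iterGram {X : Type*} [Fintype X] (m : X → ℝ) (U : X → X → ℂ) : ℕ → X → X → ℂ
  | 0 => U
  | k + 1 => gram m (iterGram m U k)

/-- Repeated squaring of a mass kernel. -/
noncomputable def iterMass {X : Type*} [Fintype X] (m : X → ℝ) (V : X → X → ℝ) : ℕ → X → X → ℝ
  | 0 => V
  | k + 1 => gramMass m (iterMass m V k)

/-- Repeated squaring of a relation. -/
def doubleRel {X : Type*} (E : X → X → Prop) : ℕ → X → X → Prop
  | 0 => E
  | k + 1 => fun a c => ∃ b, doubleRel E k a b ∧ doubleRel E k c b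

section DoubleRel

variable {X : Type*} {E : X → X → Prop}

theorem doubleRel_symm (hs : ∀ a b, E a b → E b a) (k : ℕ) {a b : X} (h : doubleRel E k a b) :
    doubleRel E k b a := by
  cases k with
  | zero => exact hs _ _ h
  | succ k => obtain ⟨c, h1, h2⟩ := h; exact ⟨c, h2, h1⟩

theorem doubleRel_left (hr : ∀ a b, E a b → E a a) (k : ℕ) {a b : X} (h : doubleRel E k a b) :
    doubleRel E k a a := by
  cases k with
  | zero => exact hr _ _ h
  | succ k => obtain ⟨c, h1, -⟩ := h; exact ⟨c, h1, h1⟩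

theorem doubleRel_succ (hs : ∀ a b, E a b → E b a) (hr : ∀ a b, E a b → E a a) (k : ℕ) {a b : X}
    (h : doubleRel E k a b) : doubleRel E (k + 1) a b :=
  ⟨b, h, doubleRel_left hr k (doubleRel_symm hs k h)⟩

theorem doubleRel_mono (hs : ∀ a b, E a b → E b a) (hr : ∀ a b, E a b → E a a) {k l : ℕ}
    (hkl : k ≤ l) {a b : X} (h : doubleRel E k a b) : doubleRel E l a b := by
  induction l, hkl using Nat.le_induction with
  | base => exact h
  | succ l _ ih => exact doubleRel_succ hs hr l ih

/-- Loops make the doubled relations increasing, and one doubling absorbs one more step of a path.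
Finiteness gives an exponent that serves all pairs at once. -/
theorem exists_doubleRel [Finite X] (hs : ∀ a b, E a b → E b a) (hr : ∀ a b, E a b → E a a) :
    ∃ k, ∀ a b, Relation.TransGen E a b → doubleRel E k a b := by
  have h1 : ∀ a b, Relation.TransGen E a b → ∃ k, doubleRel E k a b := by
    intro a b h
    induction h with
    | single h => exact ⟨0, h⟩
    | tail _ h ih =>
      obtain ⟨k, hk⟩ := ih
      exact ⟨k + 1, _, hk, doubleRel_mono hs hr (Nat.zero_le k) (hs _ _ h)⟩
  have h2 : ∀ᶠ k in Filter.atTop, ∀ a b, Relation.TransGen E a b → doubleRel E k a b := by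
    refine Filter.eventually_all.2 fun a => Filter.eventually_all.2 fun b => ?_
    by_cases h : Relation.TransGen E a b
    · obtain ⟨k, hk⟩ := h1 a b h
      filter_upwards [Filter.eventually_ge_atTop k] with l hl _
      exact doubleRel_mono hs hr hl hk
    · exact Filter.Eventually.of_forall fun k h' => absurd h' h
  exact h2.exists

theorem transGen_of_eqvGen (hs : ∀ a b, E a b → E b a) {a b : X} (ha : E a a)
    (h : Relation.EqvGen E a b) : Relation.TransGen E a b := by
  have : Relation.ReflTransGen E a b := by
    clear ha
    induction h with
    | rel _ _ h => exact Relation.ReflTransGen.single h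
    | refl => exact Relation.ReflTransGen.refl
    | symm _ _ _ ih =>
      have : Std.Symm E := ⟨hs⟩
      exact Std.Symm.symm _ _ ih
    | trans _ _ _ _ _ ih1 ih2 => exact ih1.trans ih2
  rcases Relation.reflTransGen_iff_eq_or_transGen.1 this with h | h
  · subst h
    exact Relation.TransGen.single ha
  · exact h

end DoubleRel

section Iterate

variable {X : Type*} [Fintype X] {U : X → X → ℂ} {V : X → X → ℝ} {m : X → ℝ}

theorem iterMass_comm (hs : ∀ x x', V x x' = V x' x) (k : ℕ) (x x' : X) :
    iterMass m V k x x' = iterMass m V k x' x := by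
  cases k with
  | zero => exact hs x x'
  | succ k => exact gramMass_comm x x'

/-- The two bounds feed each other in the induction; symmetry of the mass turns the row bound into
the column bound that squaring needs. -/
theorem norm_iterGram_le_and (hU : ∀ x x', ‖U x x'‖ ≤ V x x') (hs : ∀ x x', V x x' = V x' x)
    (hm : ∀ x, ∑ x', V x x' ≤ m x) (k : ℕ) :
    (∀ x x', ‖iterGram m U k x x'‖ ≤ iterMass m V k x x') ∧
      ∀ x, ∑ x', iterMass m V k x x' ≤ m x := by
  induction k with
  | zero => exact ⟨hU, hm⟩
  | succ k ih =>
    have h : ∀ x, ∑ x', iterMass m V k x' x ≤ m x := fun x => by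
      simp_rw [iterMass_comm hs k _ x]
      exact ih.2 x
    exact ⟨norm_gram_le ih.1 h, fun x => (sum_gramMass_le ih.1 h x).trans (ih.2 x)⟩

theorem norm_iterGram_le (hU : ∀ x x', ‖U x x'‖ ≤ V x x') (hs : ∀ x x', V x x' = V x' x)
    (hm : ∀ x, ∑ x', V x x' ≤ m x) (k : ℕ) (x x' : X) :
    ‖iterGram m U k x x'‖ ≤ iterMass m V k x x' :=
  (norm_iterGram_le_and hU hs hm k).1 x x'

theorem sum_iterMass_le (hU : ∀ x x', ‖U x x'‖ ≤ V x x') (hs : ∀ x x', V x x' = V x' x)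
    (hm : ∀ x, ∑ x', V x x' ≤ m x) (k : ℕ) (x : X) : ∑ x', iterMass m V k x x' ≤ m x :=
  (norm_iterGram_le_and hU hs hm k).2 x

theorem sum_iterMass_le' (hU : ∀ x x', ‖U x x'‖ ≤ V x x') (hs : ∀ x x', V x x' = V x' x)
    (hm : ∀ x, ∑ x', V x x' ≤ m x) (k : ℕ) (x : X) : ∑ x', iterMass m V k x' x ≤ m x := by
  simp_rw [iterMass_comm hs k _ x]
  exact sum_iterMass_le hU hs hm k x

theorem norm_wordSum_pow_le_iterGram (hU : ∀ x x', ‖U x x'‖ ≤ V x x')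
    (hs : ∀ x x', V x x' = V x' x) (hm : ∀ x, ∑ x', V x x' ≤ m x) (hm1 : ∑ x, m x ≤ 1) (k n : ℕ)
    (f : (Fin n → X) → ℂ) (hf : ∀ x, ‖f x‖ ≤ 1) :
    ‖wordSum n (fun ω : X × X => U ω.1 ω.2)
        (fun ω => f (fun i => (ω i).1) * star (f (fun i => (ω i).2)))‖ ^ 2 ^ k ≤
      ‖wordSum n (fun ω : X × X => iterGram m U k ω.1 ω.2)
        (fun ω => f (fun i => (ω i).1) * star (f (fun i => (ω i).2)))‖ := by
  induction k with
  | zero => simp [iterGram]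
  | succ k ih =>
    have h := norm_iterGram_le hU hs hm k
    have h' := sum_iterMass_le' hU hs hm k
    rw [pow_succ, pow_mul]
    refine (pow_le_pow_left₀ (by positivity) ih 2).trans ?_
    exact sq_norm_wordSum_le n (iterGram m U k) m (weight_nonneg h h') hm1 (kernel_eq_zero h h')
      f (fun x => star (f x)) (fun x => by rw [norm_star]; exact hf x)

theorem aligned_iterGram_self (hU : ∀ x x', ‖U x x'‖ ≤ V x x')
    (hs : ∀ x x', V x x' = V x' x) (hm : ∀ x, ∑ x', V x x' ≤ m x) {x : X}
    (h : Aligned (U x x) (V x x) 1) (k : ℕ) :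
    Aligned (iterGram m U k x x) (iterMass m V k x x) 1 := by
  induction k with
  | zero => exact h
  | succ k ih =>
    exact aligned_gram_self (norm_iterGram_le hU hs hm k) (sum_iterMass_le' hU hs hm k) ih.1

/-- At each squaring the edge is padded with the loop at `x'`, whose phase is `1`, so the phase of
the edge survives. -/
theorem aligned_iterGram (hU : ∀ x x', ‖U x x'‖ ≤ V x x')
    (hs : ∀ x x', V x x' = V x' x) (hm : ∀ x, ∑ x', V x x' ≤ m x) {x x' : X} {θ : ℂ}
    (h : Aligned (U x x') (V x x') θ) (h' : Aligned (U x' x') (V x' x') 1) (k : ℕ) :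
    Aligned (iterGram m U k x x') (iterMass m V k x x') θ := by
  induction k with
  | zero => exact h
  | succ k ih =>
    have := aligned_gram (norm_iterGram_le hU hs hm k) (sum_iterMass_le' hU hs hm k) ih
      (aligned_iterGram_self hU hs hm h' k)
    rw [star_one, mul_one] at this
    exact this

theorem iterMass_pos_of_doubleRel (hU : ∀ x x', ‖U x x'‖ ≤ V x x')
    (hs : ∀ x x', V x x' = V x' x) (hm : ∀ x, ∑ x', V x x' ≤ m x) (k : ℕ) {x x' : X}
    (h : doubleRel (fun a b => 0 < V a b) k x x') : 0 < iterMass m V k x x' := by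
  induction k generalizing x x' with
  | zero => exact h
  | succ k ih =>
    obtain ⟨b, h1, h2⟩ := h
    exact gramMass_pos (norm_iterGram_le hU hs hm k) (sum_iterMass_le' hU hs hm k) (ih h1) (ih h2)

theorem aligned_of_doubleRel (hU : ∀ x x', ‖U x x'‖ ≤ V x x')
    (hs : ∀ x x', V x x' = V x' x) (hm : ∀ x, ∑ x', V x x' ≤ m x) (k : ℕ) {x x' : X}
    (h : doubleRel (fun a b => Aligned (U a b) (V a b) 1) k x x') :
    Aligned (iterGram m U k x x') (iterMass m V k x x') 1 := by
  induction k generalizing x x' with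
  | zero => exact h
  | succ k ih =>
    obtain ⟨b, h1, h2⟩ := h
    have := aligned_gram (norm_iterGram_le hU hs hm k) (sum_iterMass_le' hU hs hm k)
      (ih h1) (ih h2)
    rw [star_one, mul_one] at this
    exact this

end Iterate

/-! ### The dichotomy for bilinear forms -/

/-- Either the word sums of a bilinear kernel of total mass `1` decay exponentially, or its phases
on each column are those of a function of the row. -/
theorem bilinear_decay_or_phase {X Y : Type*} [Fintype X] [Fintype Y] (K : X → Y → ℂ)
    (V : X → Y → ℝ) (hK : ∀ x y, ‖K x y‖ ≤ V x y) (hV : ∑ x, ∑ y, V x y ≤ 1) :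
    (∃ (N : ℕ) (r : ℝ), r < 1 ∧ ∀ (n : ℕ) (f : (Fin n → X) → ℂ) (g : (Fin n → Y) → ℂ),
        (∀ x, ‖f x‖ ≤ 1) → (∀ y, ‖g y‖ ≤ 1) →
        ‖wordSum n (fun ω : X × Y => K ω.1 ω.2)
          (fun ω => f (fun i => (ω i).1) * g (fun i => (ω i).2))‖ ^ N ≤ r ^ n) ∨
    ∃ α : X → ℂ, (∀ x, ‖α x‖ = 1) ∧ ∀ x x' y θ θ', Aligned (K x y) (V x y) θ →
      Aligned (K x' y) (V x' y) θ' → θ * star θ' = α x * star (α x') := by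
  set mY : Y → ℝ := fun y => ∑ x, V x y with hmY
  set mX : X → ℝ := fun x => ∑ y, V x y with hmX
  have hmY' : ∀ y, ∑ x, V x y ≤ mY y := fun y => le_rfl
  set U := gram mY K with hUdef
  set W := gramMass mY V with hWdef
  have hU : ∀ x x', ‖U x x'‖ ≤ W x x' := norm_gram_le hK hmY'
  have hs : ∀ x x', W x x' = W x' x := gramMass_comm
  have hm : ∀ x, ∑ x', W x x' ≤ mX x := sum_gramMass_le hK hmY'
  have hY1 : ∑ y, mY y ≤ 1 := by rw [hmY, Finset.sum_comm]; exact hV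
  have hbound : ∀ k n (f : (Fin n → X) → ℂ) (g : (Fin n → Y) → ℂ),
      (∀ x, ‖f x‖ ≤ 1) → (∀ y, ‖g y‖ ≤ 1) →
        ‖wordSum n (fun ω : X × Y => K ω.1 ω.2)
          (fun ω => f (fun i => (ω i).1) * g (fun i => (ω i).2))‖ ^ (2 * 2 ^ k) ≤
        (∑ ω : X × X, ‖iterGram mX U k ω.1 ω.2‖) ^ n := by
    intro k n f g hf hg
    rw [pow_mul]
    refine (pow_le_pow_left₀ (by positivity) (sq_norm_wordSum_le n K mY (weight_nonneg hK hmY')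
      hY1 (kernel_eq_zero hK hmY') f g hg) _).trans ?_
    refine (norm_wordSum_pow_le_iterGram hU hs hm hV k n f hf).trans (norm_wordSum_le _ _ _ ?_)
    intro ω
    rw [norm_mul, norm_star]
    exact mul_le_one₀ (hf _) (norm_nonneg _) (hf _)
  -- A strict loss at one entry of one iterate makes the ℓ¹ norm of that iterate smaller than `1`.
  by_cases hall : ∀ k x x', ‖iterGram mX U k x x'‖ = iterMass mX W k x x'
  swap
  · left
    push Not at hall
    obtain ⟨k, x, x', hne⟩ := hall
    refine ⟨2 * 2 ^ k, ∑ ω : X × X, ‖iterGram mX U k ω.1 ω.2‖, ?_, hbound k⟩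
    calc ∑ ω : X × X, ‖iterGram mX U k ω.1 ω.2‖ < ∑ ω : X × X, iterMass mX W k ω.1 ω.2 :=
          Finset.sum_lt_sum (fun ω _ => norm_iterGram_le hU hs hm k _ _)
            ⟨(x, x'), Finset.mem_univ _, lt_of_le_of_ne (norm_iterGram_le hU hs hm k _ _) hne⟩
      _ = ∑ x, ∑ x', iterMass mX W k x x' := Fintype.sum_prod_type _
      _ ≤ ∑ x, mX x := Finset.sum_le_sum fun x _ => sum_iterMass_le hU hs hm k x
      _ ≤ 1 := hV
  right
  classical
  set E : X → X → Prop := fun a b => 0 < W a b with hE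
  have hEs : ∀ a b, E a b → E b a := fun a b h => lt_of_lt_of_eq h (hs a b)
  have hVpos : ∀ a b, E a b → ∃ y, 0 < V a y ∧ 0 < V b y := by
    intro a b h
    by_contra! hcon
    refine h.ne' (Finset.sum_eq_zero fun y _ => ?_)
    rcases (mass_nonneg hK a y).eq_or_lt with h0 | h0
    · rw [← h0]; simp
    · rw [le_antisymm (hcon y h0) (mass_nonneg hK b y)]; simp
  have hEr : ∀ a b, E a b → E a a := by
    intro a b h
    obtain ⟨y, h1, -⟩ := hVpos a b h
    exact gramMass_pos hK hmY' h1 h1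
  obtain ⟨k, hk⟩ := exists_doubleRel hEs hEr
  -- A base point in each connected component of rows; `k` squarings join every row of positive mass
  -- to its base point.
  set rep : X → X := fun x => Quot.out (Quot.mk E x) with hrep
  have hreprel : ∀ x, E x x → 0 < iterMass mX W k x (rep x) := by
    intro x hx
    refine iterMass_pos_of_doubleRel hU hs hm k (hk _ _ ?_)
    refine transGen_of_eqvGen hEs hx (Relation.EqvGen.symm _ _ (Quot.eqvGen_exact ?_))
    exact Quot.out_eq _
  -- The phase of the iterated kernel from `x` to its base point. Rows of zero mass carry no aligned
  -- entry and get the default value `1`.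
  set α : X → ℂ := fun x => if E x x then
    iterGram mX U k x (rep x) / (iterMass mX W k x (rep x) : ℂ) else 1 with hα
  refine ⟨α, fun x => ?_, ?_⟩
  · by_cases hx : E x x
    · have := hreprel x hx
      simp only [hα, if_pos hx]
      rw [norm_div, hall, Complex.norm_real, Real.norm_of_nonneg this.le, div_self this.ne']
    · simp [hα, if_neg hx]
  · intro x x' y θ θ' h h'
    have hx : E x x := gramMass_pos hK hmY' h.1 h.1
    have hx' : E x' x' := gramMass_pos hK hmY' h'.1 h'.1
    have hxx' : E x x' := gramMass_pos hK hmY' h.1 h'.1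
    have hal : ∀ x, E x x → Aligned (iterGram mX U k x (rep x))
        (iterMass mX W k x (rep x)) (α x) := by
      intro x hx
      have := hreprel x hx
      refine ⟨this, fun _ => ?_⟩
      have hne : (iterMass mX W k x (rep x) : ℂ) ≠ 0 := by exact_mod_cast this.ne'
      simp only [hα, if_pos hx]
      field_simp
    have hrr : rep x = rep x' := by
      rw [hrep]
      exact congrArg Quot.out (Quot.sound hxx')
    -- The phase of one entry is found in two ways: along the path through the common base point,
    -- and along the direct step through the column `y` padded with loops.
    have h1 : Aligned (iterGram mX U (k + 1) x x') (iterMass mX W (k + 1) x x')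
        (α x * star (α x')) := by
      refine aligned_gram (norm_iterGram_le hU hs hm k) (sum_iterMass_le' hU hs hm k) (hal x hx) ?_
      rw [hrr]
      exact hal x' hx'
    have h2 : Aligned (iterGram mX U (k + 1) x x') (iterMass mX W (k + 1) x x')
        (θ * star θ') :=
      aligned_iterGram hU hs hm (aligned_gram hK hmY' h h') (aligned_gram_self hK hmY' h'.1) _
    exact h2.unique h1 (hall _ _ _)

/-! ### Doubling labelled kernels -/

/-- The doubled kernel: two copies of a kernel `K (y, u) z` glued along `z`. The labels of both
copies form the new label. -/
noncomputable def double {A U Z : Type*} [Fintype Z] (m : Z → ℝ) (K : A × U → Z → ℂ) :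
    A × (U × U) → A → ℂ :=
  fun x a => gram m K (x.1, x.2.1) (a, x.2.2)

/-- The mass of the doubled kernel. -/
noncomputable def doubleMass {A U Z : Type*} [Fintype Z] (m : Z → ℝ) (V : A × U → Z → ℝ) :
    A × (U × U) → A → ℝ :=
  fun x a => gramMass m V (x.1, x.2.1) (a, x.2.2)

/-- The form of a labelled kernel `L (y, u) a`, with the function `F` at both end points. -/
noncomputable def labelSum {A U : Type*} [Fintype A] [Fintype U] (n : ℕ) (L : A × U → A → ℂ)
    (F : (Fin n → A) → ℂ) (φ : (Fin n → U) → ℂ) : ℂ :=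
  wordSum n (fun ω : (A × U) × A => L ω.1 ω.2)
    (fun ω => (F (fun i => (ω i).1.1) * φ (fun i => (ω i).1.2)) * star (F (fun i => (ω i).2)))

/-- `L` is a labelled kernel with masses `V`, whose marginals at both end points are at most `m`. -/
structure IsLabelled {A U : Type*} [Fintype A] [Fintype U] (m : A → ℝ) (L : A × U → A → ℂ)
    (V : A × U → A → ℝ) : Prop where
  norm_le : ∀ x a, ‖L x a‖ ≤ V x a
  left : ∀ y, ∑ u, ∑ a, V (y, u) a ≤ m y
  right : ∀ a, ∑ x, V x a ≤ m a

theorem sum_gramMass_double_le {A U Z : Type*} [Fintype A] [Fintype U] [Fintype Z]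
    {mA : A → ℝ} {m : Z → ℝ} {K : A × U → Z → ℂ} {V : A × U → Z → ℝ}
    (hK : ∀ x z, ‖K x z‖ ≤ V x z) (hm : ∀ z, ∑ x, V x z ≤ m z)
    (hl : ∀ y, ∑ u, ∑ z, V (y, u) z ≤ mA y) (y : A) :
    ∑ u, ∑ x, gramMass m V (y, u) x ≤ mA y :=
  (Finset.sum_le_sum fun u _ => sum_gramMass_le hK hm (y, u)).trans (hl y)

theorem isLabelled_double {A U Z : Type*} [Fintype A] [Fintype U] [Fintype Z]
    {mA : A → ℝ} {m : Z → ℝ} {K : A × U → Z → ℂ} {V : A × U → Z → ℝ}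
    (hK : ∀ x z, ‖K x z‖ ≤ V x z) (hm : ∀ z, ∑ x, V x z ≤ m z)
    (hl : ∀ y, ∑ u, ∑ z, V (y, u) z ≤ mA y) :
    IsLabelled mA (double m K) (doubleMass m V) where
  norm_le x a := norm_gram_le hK hm _ _
  left y := by
    refine le_trans (le_of_eq ?_) (sum_gramMass_double_le hK hm hl y)
    simp only [doubleMass, Fintype.sum_prod_type]
    exact Finset.sum_congr rfl fun u _ => Finset.sum_comm
  right a := by
    refine le_trans (le_of_eq ?_) (sum_gramMass_double_le hK hm hl a)
    simp only [doubleMass, Fintype.sum_prod_type]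
    simp_rw [gramMass_comm (m := m) (V := V) (a, _)]
    calc _ = ∑ y, ∑ u', ∑ u, gramMass m V (y, u) (a, u') :=
          Finset.sum_congr rfl fun y _ => Finset.sum_comm
      _ = _ := Finset.sum_comm

/-- Cauchy–Schwarz removes `g`. Of the two copies of `F`, one stays at the left end and the other
becomes the right end, while both labels are kept. -/
theorem sq_norm_le_labelSum_double {A U Z : Type*} [Fintype A] [Fintype U] [Fintype Z]
    {m : Z → ℝ} {K : A × U → Z → ℂ} {V : A × U → Z → ℝ}
    (hK : ∀ x z, ‖K x z‖ ≤ V x z) (hm : ∀ z, ∑ x, V x z ≤ m z) (hm1 : ∑ z, m z ≤ 1) (n : ℕ)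
    (F : (Fin n → A) → ℂ) (φ : (Fin n → U) → ℂ) (g : (Fin n → Z) → ℂ) (hg : ∀ z, ‖g z‖ ≤ 1) :
    ‖wordSum n (fun ω : (A × U) × Z => K ω.1 ω.2)
      (fun ω => (F (fun i => (ω i).1.1) * φ (fun i => (ω i).1.2)) * g (fun i => (ω i).2))‖ ^ 2 ≤
    ‖labelSum n (double m K) F
      (fun u => φ (fun i => (u i).1) * star (φ (fun i => (u i).2)))‖ := by
  refine (sq_norm_wordSum_le n K m (weight_nonneg hK hm) hm1 (kernel_eq_zero hK hm)
    (fun x => F (fun i => (x i).1) * φ (fun i => (x i).2)) g hg).trans (le_of_eq ?_)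
  let e : (A × (U × U)) × A ≃ (A × U) × (A × U) :=
    ⟨fun x => ((x.1.1, x.1.2.1), (x.2, x.1.2.2)), fun x => ((x.1.1, (x.1.2, x.2.2)), x.2.1),
      fun _ => rfl, fun _ => rfl⟩
  rw [wordSum_equiv n e, labelSum]
  congr 1
  refine Finset.sum_congr rfl fun ω _ => ?_
  simp only [e, Equiv.coe_fn_mk, double, star_mul]
  ring

theorem sq_norm_labelSum_le {A U : Type*} [Fintype A] [Fintype U] {m : A → ℝ}
    {L : A × U → A → ℂ} {V : A × U → A → ℝ} (hL : IsLabelled m L V) (hm1 : ∑ a, m a ≤ 1) (n : ℕ)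
    (F : (Fin n → A) → ℂ) (hF : ∀ a, ‖F a‖ ≤ 1) (φ : (Fin n → U) → ℂ) :
    ‖labelSum n L F φ‖ ^ 2 ≤
      ‖labelSum n (double m L) F (fun u => φ (fun i => (u i).1) * star (φ (fun i => (u i).2)))‖ :=
  sq_norm_le_labelSum_double hL.norm_le hL.right hm1 n F φ (fun a => star (F a))
    (fun a => by rw [norm_star]; exact hF a)

/-! ### From trilinear forms to kernels labelled by pairs of letters -/

/-- The sum over triples of words of a product weight times a product of functions. -/
noncomputable def triSum {A B C : Type*} [Fintype A] [Fintype B] [Fintype C] (n : ℕ)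
    (w : A → B → C → ℂ) (F : (Fin n → A) → ℂ) (G : (Fin n → B) → ℂ) (H : (Fin n → C) → ℂ) : ℂ :=
  ∑ a : Fin n → A, ∑ b : Fin n → B, ∑ c : Fin n → C, (∏ i, w (a i) (b i) (c i)) * (F a * G b * H c)

/-- `a` and `a'` have a common neighbour in the second alphabet. -/
def ShareSnd {A B C : Type*} (μ : A → B → C → ℝ) (a a' : A) : Prop :=
  ∃ b, (∃ c, 0 < μ a b c) ∧ ∃ c, 0 < μ a' b c

/-- `a` and `a'` have a common neighbour in the third alphabet. -/
def ShareThd {A B C : Type*} (μ : A → B → C → ℝ) (a a' : A) : Prop :=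
  ∃ c, (∃ b, 0 < μ a b c) ∧ ∃ b, 0 < μ a' b c

/-- The first marginal. -/
def fstMarginal {A B C : Type*} [Fintype B] [Fintype C] (μ : A → B → C → ℝ) (a : A) : ℝ :=
  ∑ b, ∑ c, μ a b c

universe uA uB uC

section Gadget

variable {A : Type uA} {B : Type uB} {C : Type uC} [Fintype A] [Fintype B] [Fintype C]
  {w : A → B → C → ℂ} {μ : A → B → C → ℝ}

/-- Cauchy–Schwarz eliminates `H`, then the right-hand copy of `F` repeatedly. Doubling spreads the
mass along connections through the third alphabet, whereas a neighbour shared in the second alphabet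
survives as a label common to two loops. -/
theorem exists_labelled_of_doubleRel (hw : ∀ a b c, ‖w a b c‖ ≤ μ a b c)
    (hμ : ∑ a, fstMarginal μ a ≤ 1) (k : ℕ) :
    ∃ (U : Type uB) (_ : Fintype U) (L : A × U → A → ℂ) (V : A × U → A → ℝ) (N : ℕ),
      IsLabelled (fstMarginal μ) L V ∧
      (∀ (n : ℕ) (F : (Fin n → A) → ℂ) (G : (Fin n → B) → ℂ) (H : (Fin n → C) → ℂ),
        (∀ a, ‖F a‖ ≤ 1) → (∀ b, ‖G b‖ ≤ 1) → (∀ c, ‖H c‖ ≤ 1) →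
        ∃ φ : (Fin n → U) → ℂ, (∀ u, ‖φ u‖ ≤ 1) ∧ ‖triSum n w F G H‖ ^ N ≤ ‖labelSum n L F φ‖) ∧
      (∀ y a, doubleRel (ShareThd μ) k y a → ∃ u, 0 < V (y, u) a) ∧
      ∀ y a, ShareSnd μ y a → ∃ u, Aligned (L (y, u) y) (V (y, u) y) 1 ∧
        Aligned (L (a, u) a) (V (a, u) a) 1 := by
  have hμ0 : ∀ a b c, 0 ≤ μ a b c := fun a b c => (norm_nonneg _).trans (hw a b c)
  induction k with
  | zero =>
    set K : A × B → C → ℂ := fun x c => w x.1 x.2 c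
    set V : A × B → C → ℝ := fun x c => μ x.1 x.2 c
    set m : C → ℝ := fun c => ∑ x, V x c
    have hK : ∀ x c, ‖K x c‖ ≤ V x c := fun x c => hw _ _ _
    have hm : ∀ c, ∑ x, V x c ≤ m c := fun c => le_rfl
    have hm1 : ∑ c, m c ≤ 1 := by
      refine le_trans (le_of_eq ?_) hμ
      simp only [m, V, fstMarginal]
      rw [Finset.sum_comm, Fintype.sum_prod_type]
    refine ⟨B × B, inferInstance, double m K, doubleMass m V, 2,
      isLabelled_double hK hm fun y => le_rfl, ?_, ?_, ?_⟩
    · intro n F G H hF hG hH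
      refine ⟨fun u => G (fun i => (u i).1) * star (G (fun i => (u i).2)), fun u => ?_, ?_⟩
      · rw [norm_mul, norm_star]
        exact mul_le_one₀ (hG _) (norm_nonneg _) (hG _)
      · refine le_trans (le_of_eq ?_) (sq_norm_le_labelSum_double hK hm hm1 n F G H hH)
        simp only [wordSum, sum_arrow_prod]
        rfl
    · rintro y a ⟨c, ⟨b, hb⟩, b', hb'⟩
      exact ⟨(b, b'), gramMass_pos hK hm (y := c) hb hb'⟩
    · rintro y a ⟨b, ⟨c, hc⟩, c', hc'⟩
      -- The label `(b, b)` does not involve `c` or `c'`, so it serves both loops although the third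
      -- letters may differ.
      exact ⟨(b, b), aligned_gram_self hK hm (y := c) hc, aligned_gram_self hK hm (y := c') hc'⟩
  | succ k ih =>
    obtain ⟨U, _, L, V, N, hL, hbound, hE, hD⟩ := ih
    refine ⟨U × U, inferInstance, double (fstMarginal μ) L, doubleMass (fstMarginal μ) V, N * 2,
      isLabelled_double hL.norm_le hL.right hL.left, ?_, ?_, ?_⟩
    · intro n F G H hF hG hH
      obtain ⟨φ, hφ, h⟩ := hbound n F G H hF hG hH
      refine ⟨fun u => φ (fun i => (u i).1) * star (φ (fun i => (u i).2)), fun u => ?_, ?_⟩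
      · rw [norm_mul, norm_star]
        exact mul_le_one₀ (hφ _) (norm_nonneg _) (hφ _)
      · rw [pow_mul]
        exact (pow_le_pow_left₀ (by positivity) h 2).trans (sq_norm_labelSum_le hL hμ n F hF φ)
    · rintro y a ⟨b, h1, h2⟩
      obtain ⟨u, hu⟩ := hE _ _ h1
      obtain ⟨u', hu'⟩ := hE _ _ h2
      exact ⟨(u, u'), gramMass_pos hL.norm_le hL.right hu hu'⟩
    · intro y a h
      obtain ⟨u, h1, h2⟩ := hD y a h
      exact ⟨(u, u), aligned_gram_self hL.norm_le hL.right h1.1,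
        aligned_gram_self hL.norm_le hL.right h2.1⟩

/-- The first closure: the labels are pairs of letters of the first alphabet, and the kernel
contains all trivial configurations. -/
theorem exists_pair_labelled (hw : ∀ a b c, ‖w a b c‖ ≤ μ a b c)
    (hμ : ∑ a, fstMarginal μ a ≤ 1)
    (hsnd : ∀ a a', Relation.TransGen (ShareSnd μ) a a')
    (hthd : ∀ a a', Relation.TransGen (ShareThd μ) a a') :
    ∃ (L : A × (A × A) → A → ℂ) (V : A × (A × A) → A → ℝ) (N : ℕ),
      IsLabelled (fstMarginal μ) L V ∧
      (∀ (n : ℕ) (F : (Fin n → A) → ℂ) (G : (Fin n → B) → ℂ) (H : (Fin n → C) → ℂ),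
        (∀ a, ‖F a‖ ≤ 1) → (∀ b, ‖G b‖ ≤ 1) → (∀ c, ‖H c‖ ≤ 1) →
        ‖triSum n w F G H‖ ^ N ≤
          ‖labelSum n L F (fun u => star (F (fun i => (u i).1)) * F (fun i => (u i).2))‖) ∧
      (∀ y a, Aligned (L (y, (y, a)) a) (V (y, (y, a)) a) 1) ∧
      ∀ y a, Aligned (L (y, (a, a)) y) (V (y, (a, a)) y) 1 := by
  have hthd_symm : ∀ a b, ShareThd μ a b → ShareThd μ b a := fun a b ⟨c, h1, h2⟩ => ⟨c, h2, h1⟩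
  have hthd_left : ∀ a b, ShareThd μ a b → ShareThd μ a a := fun a b ⟨c, h1, _⟩ => ⟨c, h1, h1⟩
  obtain ⟨k, hk⟩ := exists_doubleRel hthd_symm hthd_left
  obtain ⟨U, _, L, V, N, hL, hbound, hE, hD⟩ := exists_labelled_of_doubleRel hw hμ k
  replace hE : ∀ y a, ∃ u, 0 < V (y, u) a := fun y a => hE _ _ (hk _ _ (hthd _ _))
  -- The two end points are grouped into one variable, so that the uncontrolled label function `φ`
  -- can be eliminated by Cauchy–Schwarz. The new labels are then pairs of end points, carrying only
  -- `F`.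
  set K : A × A → U → ℂ := fun x u => L (x.1, u) x.2 with hKdef
  set W : A × A → U → ℝ := fun x u => V (x.1, u) x.2 with hWdef
  set m : U → ℝ := fun u => ∑ x, W x u with hmdef
  set m₂ : A × A → ℝ := fun x => ∑ u, W x u with hm₂def
  have hK : ∀ x u, ‖K x u‖ ≤ W x u := fun x u => hL.norm_le _ _
  have hm : ∀ u, ∑ x, W x u ≤ m u := fun u => le_rfl
  have hleft : ∀ y, ∑ a, m₂ (y, a) ≤ fstMarginal μ y := fun y => by
    refine le_trans (le_of_eq ?_) (hL.left y)
    simp only [hm₂def, hWdef]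
    exact Finset.sum_comm
  have hright : ∀ a, ∑ y, m₂ (y, a) ≤ fstMarginal μ a := fun a => by
    refine le_trans (le_of_eq ?_) (hL.right a)
    simp only [hm₂def, hWdef, Fintype.sum_prod_type]
  have hm₂1 : ∑ x, m₂ x ≤ 1 := by
    rw [Fintype.sum_prod_type]
    exact (Finset.sum_le_sum fun y _ => hleft y).trans hμ
  have hm1 : ∑ u, m u ≤ 1 := by
    rw [hmdef, Finset.sum_comm]
    exact hm₂1
  have hU : ∀ x x', ‖gram m K x x'‖ ≤ gramMass m W x x' := norm_gram_le hK hm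
  have hs : ∀ x x', gramMass m W x x' = gramMass m W x' x := gramMass_comm
  have hmm : ∀ x, ∑ x', gramMass m W x x' ≤ m₂ x := sum_gramMass_le hK hm
  set E : A × A → A × A → Prop :=
      fun x x' => Aligned (gram m K x x') (gramMass m W x x') 1 with hEdef
  have hEr : ∀ x, E x x := by
    rintro ⟨y, a⟩
    obtain ⟨u, hu⟩ := hE y a
    exact aligned_gram_self hK hm (y := u) hu
  have hgs : ∀ x x', gram m K x' x = star (gram m K x x') := by
    intro x x'
    simp only [gram, star_sum]
    refine Finset.sum_congr rfl fun u _ => ?_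
    rw [star_div₀, star_mul, star_star]
    simp
  have hEs : ∀ x x', E x x' → E x' x := by
    intro x x' h
    have := Aligned.star h
    rw [star_one, ← hgs, hs] at this
    exact this
  -- Diagonal pairs with a common loop label are adjacent, so connectivity through the second
  -- alphabet links the whole diagonal.
  have hEd : ∀ y a, ShareSnd μ y a → E (y, y) (a, a) := by
    intro y a h
    obtain ⟨u, h1, h2⟩ := hD y a h
    have := aligned_gram hK hm (x := (y, y)) (x' := (a, a)) (y := u) h1 h2
    rw [star_one, one_mul] at this
    exact this
  have hEt : ∀ y a, Relation.TransGen E (y, y) (a, a) := fun y a =>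
    Relation.TransGen.lift (fun y => (y, y)) hEd _ _ (hsnd y a)
  obtain ⟨j, hj⟩ := exists_doubleRel hEs (fun x _ _ => hEr x)
  have hal : ∀ x x', Relation.TransGen E x x' →
      Aligned (iterGram m₂ (gram m K) j x x') (iterMass m₂ (gramMass m W) j x x') 1 :=
    fun x x' h => aligned_of_doubleRel hU hs hmm j (hj x x' h)
  have hn := norm_iterGram_le hU hs hmm j
  have hr := sum_iterMass_le hU hs hmm j
  refine ⟨fun x a => iterGram m₂ (gram m K) j (x.1, a) x.2,
    fun x a => iterMass m₂ (gramMass m W) j (x.1, a) x.2, N * (2 * 2 ^ j), ⟨fun x a => hn _ _, ?_,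
        ?_⟩,
    ?_, fun y a => hal _ _ (Relation.TransGen.single (hEr _)), fun y a => hal _ _ (hEt _ _)⟩
  · intro y
    rw [Finset.sum_comm]
    exact (Finset.sum_le_sum fun a _ => hr (y, a)).trans (hleft y)
  · intro a
    rw [Fintype.sum_prod_type]
    exact (Finset.sum_le_sum fun y _ => hr (y, a)).trans (hright a)
  · intro n F G H hF hG hH
    obtain ⟨φ, hφ, h⟩ := hbound n F G H hF hG hH
    set f : (Fin n → A × A) → ℂ := fun x => F (fun i => (x i).1) * star (F (fun i => (x i).2))
      with hf
    have hf1 : ∀ x, ‖f x‖ ≤ 1 := fun x => by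
      rw [hf, norm_mul, norm_star]
      exact mul_le_one₀ (hF _) (norm_nonneg _) (hF _)
    rw [pow_mul, pow_mul]
    refine (pow_le_pow_left₀ (by positivity) (pow_le_pow_left₀ (by positivity) h 2) _).trans ?_
    have h1 : labelSum n L F φ = wordSum n (fun ω : (A × A) × U => K ω.1 ω.2)
        (fun ω => f (fun i => (ω i).1) * φ (fun i => (ω i).2)) := by
      let e : (A × A) × U ≃ (A × U) × A :=
        ⟨fun x => ((x.1.1, x.2), x.1.2), fun x => ((x.1.1, x.2), x.1.2), fun _ => rfl, fun _ => rfl⟩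
      rw [labelSum, wordSum_equiv n e]
      refine Finset.sum_congr rfl fun ω _ => ?_
      simp only [e, Equiv.coe_fn_mk, hf, hKdef]
      ring
    rw [h1]
    refine (pow_le_pow_left₀ (by positivity) (sq_norm_wordSum_le n K m (weight_nonneg hK hm) hm1
      (kernel_eq_zero hK hm) f φ hφ) _).trans ?_
    refine (norm_wordSum_pow_le_iterGram hU hs hmm hm₂1 j n f hf1).trans (le_of_eq ?_)
    let e : (A × (A × A)) × A ≃ (A × A) × (A × A) :=
      ⟨fun x => ((x.1.1, x.2), x.1.2), fun x => ((x.1.1, x.2), x.1.2), fun _ => rfl, fun _ => rfl⟩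
    rw [labelSum, wordSum_equiv n e]
    congr 1
    refine Finset.sum_congr rfl fun ω _ => ?_
    simp only [e, Equiv.coe_fn_mk, hf, star_mul, star_star]
    ring

end Gadget

/-! ### Registers -/

/-- `L` is a labelled kernel whose labels carry plus letters `P` and minus letters `M`, and which
contains registers indexed by `ι`. The word `b` of registers can be passed unchanged (label `up b`);
the letter `b k` can be moved from the left end point to its register (label `ux b k t`), or from
the register to the right end point (label `us b k t`). -/
structure HasRegisters {A U X Y ι : Type*} [DecidableEq ι] (L : A × U → A → ℂ) (V : A × U → A → ℝ)
    (P : U → X) (M : U → Y) (up : (ι → A) → U) (ux us : (ι → A) → ι → A → U) : Prop where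
  pass : ∀ b t, Aligned (L (t, up b) t) (V (t, up b) t) 1
  out : ∀ b k t, Aligned (L (b k, ux b k t) t) (V (b k, ux b k t) t) 1
  out_plus : ∀ b k t, P (ux b k t) = P (up b)
  out_minus : ∀ b k t y, M (ux (Function.update b k y) k t) = M (ux b k t)
  inn : ∀ b k t, Aligned (L (t, us b k t) (b k)) (V (t, us b k t) (b k)) 1
  inn_minus : ∀ b k t, M (us b k t) = M (up b)
  inn_plus : ∀ b k t y, P (us (Function.update b k y) k t) = P (us b k t)

section Registers

variable {A U X Y ι : Type*} [Fintype A] [Fintype U] [DecidableEq ι] {m : A → ℝ}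
  {L : A × U → A → ℂ} {V : A × U → A → ℝ} {P : U → X} {M : U → Y} {up : (ι → A) → U}
  {ux us : (ι → A) → ι → A → U}

theorem aligned_double (hL : IsLabelled m L V) {y a z : A} {u u' : U}
    (h : Aligned (L (y, u) z) (V (y, u) z) 1) (h' : Aligned (L (a, u') z) (V (a, u') z) 1) :
    Aligned (double m L (y, (u, u')) a) (doubleMass m V (y, (u, u')) a) 1 := by
  have := aligned_gram hL.norm_le hL.right h h'
  rw [star_one, one_mul] at this
  exact this

/-- One copy uses a register while the other passes. The second copy is conjugated and traversed
backwards, so there plus and minus letters trade places, and so do moving out and moving in; this is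
why both moves belong to the structure. -/
theorem HasRegisters.double (hL : IsLabelled m L V) (h : HasRegisters L V P M up ux us) :
    HasRegisters (_root_.double m L) (doubleMass m V) (fun u => (P u.1, M u.2))
      (fun u => (M u.1, P u.2))
      (fun b : ι ⊕ ι → A => (up (b ∘ Sum.inl), up (b ∘ Sum.inr)))
      (fun b k t => k.elim (fun k => (ux (b ∘ Sum.inl) k t, up (b ∘ Sum.inr)))
        (fun k => (up (b ∘ Sum.inl), us (b ∘ Sum.inr) k t)))
      (fun b k t => k.elim (fun k => (us (b ∘ Sum.inl) k t, up (b ∘ Sum.inr)))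
        (fun k => (up (b ∘ Sum.inl), ux (b ∘ Sum.inr) k t))) where
  pass b t := aligned_double hL (h.pass _ t) (h.pass _ t)
  out b k t := by
    rcases k with k | k
    · exact aligned_double hL (h.out (b ∘ Sum.inl) k t) (h.pass _ t)
    · exact aligned_double hL (h.pass _ _) (h.inn _ k t)
  out_plus b k t := by
    rcases k with k | k
    · simp [h.out_plus]
    · simp [h.inn_minus]
  out_minus b k t y := by
    rcases k with k | k
    · simp [h.out_minus]
    · simp [h.inn_plus]
  inn b k t := by
    rcases k with k | k
    · exact aligned_double hL (h.inn _ k t) (h.pass _ _)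
    · exact aligned_double hL (h.pass _ t) (h.out (b ∘ Sum.inr) k t)
  inn_minus b k t := by
    rcases k with k | k
    · simp [h.inn_minus]
    · simp [h.out_plus]
  inn_plus b k t y := by
    rcases k with k | k
    · simp [h.inn_plus]
    · simp [h.out_minus]

end Registers

section Gadget

variable {A : Type uA} {B : Type uB} {C : Type uC} [Fintype B] [Fintype C]
  {w : A → B → C → ℂ} {μ : A → B → C → ℝ}

/-- The kernel labelled by pairs has one register, and each doubling doubles their number. -/
theorem exists_registers [Fintype A] (hw : ∀ a b c, ‖w a b c‖ ≤ μ a b c)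
    (hμ : ∑ a, fstMarginal μ a ≤ 1)
    (hsnd : ∀ a a', Relation.TransGen (ShareSnd μ) a a')
    (hthd : ∀ a a', Relation.TransGen (ShareThd μ) a a') (k : ℕ) :
    ∃ (U X Y : Type uA) (_ : Fintype U) (_ : Fintype X) (_ : Fintype Y) (P : U → X) (M : U → Y)
      (L : A × U → A → ℂ) (V : A × U → A → ℝ) (N : ℕ) (ι : Type) (_ : Fintype ι)
      (_ : DecidableEq ι) (up : (ι → A) → U) (ux us : (ι → A) → ι → A → U),
      k < Fintype.card ι ∧ IsLabelled (fstMarginal μ) L V ∧ HasRegisters L V P M up ux us ∧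
      ∀ (n : ℕ) (F : (Fin n → A) → ℂ) (G : (Fin n → B) → ℂ) (H : (Fin n → C) → ℂ),
        (∀ a, ‖F a‖ ≤ 1) → (∀ b, ‖G b‖ ≤ 1) → (∀ c, ‖H c‖ ≤ 1) →
        ∃ (f : (Fin n → X) → ℂ) (g : (Fin n → Y) → ℂ), (∀ x, ‖f x‖ ≤ 1) ∧ (∀ y, ‖g y‖ ≤ 1) ∧
          ‖triSum n w F G H‖ ^ N ≤
            ‖labelSum n L F (fun u => f (fun i => P (u i)) * g (fun i => M (u i)))‖ := by
  induction k with
  | zero =>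
    obtain ⟨L, V, N, hL, hbound, hex, hpass⟩ := exists_pair_labelled hw hμ hsnd hthd
    -- The label `(b, b)` passes any `t`; `(b, t)` leads from `b` to `t` and `(t, b)` from `t` to
    -- `b`, both being trivial configurations.
    refine ⟨A × A, A, A, inferInstance, inferInstance, inferInstance, Prod.fst, Prod.snd, L, V, N,
      Unit, inferInstance, inferInstance, fun b => (b (), b ()), fun b _ t => (b (), t),
      fun b _ t => (t, b ()), by simp, hL, ?_, ?_⟩
    · exact
        { pass := fun b t => hpass t _
          out := fun b _ t => hex _ _
          out_plus := fun b _ t => rfl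
          out_minus := fun b _ t y => rfl
          inn := fun b _ t => hex _ _
          inn_minus := fun b _ t => rfl
          inn_plus := fun b _ t y => rfl }
    · intro n F G H hF hG hH
      exact ⟨fun x => star (F x), F, fun x => by rw [norm_star]; exact hF x, hF,
        hbound n F G H hF hG hH⟩
  | succ k ih =>
    obtain ⟨U, X, Y, _, _, _, P, M, L, V, N, ι, _, _, up, ux, us, hcard, hL, hreg, hbound⟩ := ih
    refine ⟨U × U, X × Y, Y × X, inferInstance, inferInstance, inferInstance, _, _,
      double (fstMarginal μ) L, doubleMass (fstMarginal μ) V, N * 2, ι ⊕ ι, inferInstance,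
      inferInstance, _, _, _, ?_, isLabelled_double hL.norm_le hL.right hL.left, hreg.double hL, ?_⟩
    · rw [Fintype.card_sum]; omega
    · intro n F G H hF hG hH
      obtain ⟨f, g, hf, hg, h⟩ := hbound n F G H hF hG hH
      refine ⟨fun x => f (fun i => (x i).1) * star (g (fun i => (x i).2)),
        fun y => g (fun i => (y i).1) * star (f (fun i => (y i).2)), fun x => ?_, fun y => ?_, ?_⟩
      · rw [norm_mul, norm_star]
        exact mul_le_one₀ (hf _) (norm_nonneg _) (hg _)
      · rw [norm_mul, norm_star]
        exact mul_le_one₀ (hg _) (norm_nonneg _) (hf _)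
      · rw [pow_mul]
        refine (pow_le_pow_left₀ (by positivity) h 2).trans ?_
        refine (sq_norm_labelSum_le hL hμ n F hF _).trans (le_of_eq ?_)
        congr 2
        funext u
        rw [star_mul]
        ring

/-! ### Dual functions -/

/-- The value of a dual function: the average of letters attached to the letters of `y`. -/
noncomputable def dualFun {W X Y : Type*} [Fintype W] (n : ℕ) (ρ : A → W → ℂ) (p : W → X)
    (q : W → Y) (f : (Fin n → X) → ℂ) (g : (Fin n → Y) → ℂ) (y : Fin n → A) : ℂ :=
  ∑ ω : Fin n → W, (∏ i, ρ (y i) (ω i)) * (f (fun i => p (ω i)) * g (fun i => q (ω i)))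

theorem norm_dualFun_le {W X Y : Type*} [Fintype W] (n : ℕ) {ρ : A → W → ℂ} {v : A → W → ℝ}
    (hρ : ∀ y ω, ‖ρ y ω‖ ≤ v y ω) (hv : ∀ y, ∑ ω, v y ω ≤ 1) (p : W → X)
    (q : W → Y) {f : (Fin n → X) → ℂ} {g : (Fin n → Y) → ℂ} (hf : ∀ x, ‖f x‖ ≤ 1)
    (hg : ∀ y, ‖g y‖ ≤ 1) (y : Fin n → A) : ‖dualFun n ρ p q f g y‖ ≤ 1 := by
  have h1 : ‖dualFun n ρ p q f g y‖ ≤ ∑ ω : Fin n → W, ∏ i, v (y i) (ω i) := by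
    refine norm_sum_le_of_le _ fun ω _ => ?_
    rw [norm_mul, norm_prod, norm_mul]
    refine (mul_le_of_le_one_right (by positivity)
      (mul_le_one₀ (hf _) (norm_nonneg _) (hg _))).trans ?_
    exact Finset.prod_le_prod (fun _ _ => norm_nonneg _) fun i _ => hρ _ _
  refine h1.trans ?_
  rw [← prod_sum_words n (fun i ω => v (y i) ω)]
  exact Finset.prod_le_one
    (fun i _ => Finset.sum_nonneg fun ω _ => (norm_nonneg _).trans (hρ _ _)) (fun i _ => hv _)

/-- The partial sum over the second and third words. -/
noncomputable def partialSum (n : ℕ) (w : A → B → C → ℂ) (G : (Fin n → B) → ℂ)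
    (H : (Fin n → C) → ℂ) (a : Fin n → A) : ℂ :=
  ∑ b : Fin n → B, ∑ c : Fin n → C, (∏ i, w (a i) (b i) (c i)) * (G b * H c)

theorem triSum_eq [Fintype A] (n : ℕ) (w : A → B → C → ℂ) (F : (Fin n → A) → ℂ)
    (G : (Fin n → B) → ℂ)
    (H : (Fin n → C) → ℂ) : triSum n w F G H = ∑ a, F a * partialSum n w G H a := by
  simp only [triSum, partialSum, Finset.mul_sum]
  refine Finset.sum_congr rfl fun a _ => Finset.sum_congr rfl fun b _ =>
    Finset.sum_congr rfl fun c _ => by ring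

theorem norm_partialSum_le (hw : ∀ a b c, ‖w a b c‖ ≤ μ a b c) (n : ℕ) {G : (Fin n → B) → ℂ}
    {H : (Fin n → C) → ℂ} (hG : ∀ b, ‖G b‖ ≤ 1) (hH : ∀ c, ‖H c‖ ≤ 1) (a : Fin n → A) :
    ‖partialSum n w G H a‖ ≤ ∏ i, fstMarginal μ (a i) := by
  have h : ∏ i, fstMarginal μ (a i) =
      ∑ b : Fin n → B, ∑ c : Fin n → C, ∏ i, μ (a i) (b i) (c i) := by
    simp only [fstMarginal]
    simp_rw [prod_sum_words n]
  rw [h]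
  refine norm_sum_le_of_le _ fun b _ => norm_sum_le_of_le _ fun c _ => ?_
  rw [norm_mul, norm_prod, norm_mul]
  refine (mul_le_of_le_one_right (by positivity)
    (mul_le_one₀ (hG _) (norm_nonneg _) (hH _))).trans ?_
  exact Finset.prod_le_prod (fun _ _ => norm_nonneg _) fun i _ => hw _ _ _

/-- In a trilinear form, the first function may be replaced by a dual function. -/
theorem exists_dualFun_of_labelled [Fintype A] {U X Y : Type*} [Fintype U]
    {L : A × U → A → ℂ} {P : U → X} {M : U → Y} {N : ℕ}
    (hw : ∀ a b c, ‖w a b c‖ ≤ μ a b c)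
    (hμ : ∑ a, fstMarginal μ a ≤ 1) (hpos : ∀ a, 0 < fstMarginal μ a) (n : ℕ)
    (hbound : ∀ (F : (Fin n → A) → ℂ) (G : (Fin n → B) → ℂ) (H : (Fin n → C) → ℂ),
        (∀ a, ‖F a‖ ≤ 1) → (∀ b, ‖G b‖ ≤ 1) → (∀ c, ‖H c‖ ≤ 1) →
        ∃ (f : (Fin n → X) → ℂ) (g : (Fin n → Y) → ℂ), (∀ x, ‖f x‖ ≤ 1) ∧ (∀ y, ‖g y‖ ≤ 1) ∧
          ‖triSum n w F G H‖ ^ N ≤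
            ‖labelSum n L F (fun u => f (fun i => P (u i)) * g (fun i => M (u i)))‖)
    (F : (Fin n → A) → ℂ) (G : (Fin n → B) → ℂ) (H : (Fin n → C) → ℂ)
    (hF : ∀ a, ‖F a‖ ≤ 1) (hG : ∀ b, ‖G b‖ ≤ 1) (hH : ∀ c, ‖H c‖ ≤ 1) :
    ∃ (f : (Fin n → X × A) → ℂ) (g : (Fin n → Y) → ℂ), (∀ x, ‖f x‖ ≤ 1) ∧ (∀ y, ‖g y‖ ≤ 1) ∧
      ‖triSum n w F G H‖ ^ (2 * N) ≤
        ‖triSum n w (dualFun n (fun y (ω : U × A) => star (L (y, ω.1) ω.2) / (fstMarginal μ y : ℂ))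
          (fun ω => (P ω.1, ω.2)) (fun ω => M ω.1) f g) G H‖ := by
  set mm : (Fin n → A) → ℝ := fun a => ∏ i, fstMarginal μ (a i) with hmm
  have hmpos : ∀ a, 0 < mm a := fun a => Finset.prod_pos fun i _ => hpos _
  have hmne : ∀ a, (mm a : ℂ) ≠ 0 := fun a => by exact_mod_cast (hmpos a).ne'
  have hmsum : ∑ a, mm a ≤ 1 := by
    rw [hmm, ← prod_sum_words n (fun _ y => fstMarginal μ y)]
    exact Finset.prod_le_one (fun i _ => Finset.sum_nonneg fun a _ => (hpos a).le) (fun i _ => hμ)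
  set Q := partialSum n w G H with hQ
  have hQle : ∀ a, ‖Q a‖ ≤ mm a := norm_partialSum_le hw n hG hH
  -- The extremal choice up to normalisation: it makes the form equal to `∑ ‖Q‖² / mm`, which
  -- dominates the square of the original form.
  set F₀ : (Fin n → A) → ℂ := fun a => star (Q a) / mm a with hF₀
  have hF₀1 : ∀ a, ‖F₀ a‖ ≤ 1 := fun a => by
    rw [hF₀, norm_div, norm_star, Complex.norm_real, Real.norm_of_nonneg (hmpos a).le]
    exact (div_le_one (hmpos a)).2 (hQle a)
  have h1 : ‖triSum n w F G H‖ ^ 2 ≤ ‖triSum n w F₀ G H‖ := by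
    have h2 : triSum n w F₀ G H = ((∑ a, ‖Q a‖ ^ 2 / mm a : ℝ) : ℂ) := by
      rw [triSum_eq]
      push_cast
      refine Finset.sum_congr rfl fun a _ => ?_
      rw [hF₀, ← Complex.mul_conj', starRingEnd_apply]
      ring
    have hnn : ∀ a, 0 ≤ ‖Q a‖ ^ 2 / mm a := fun a => div_nonneg (by positivity) (hmpos a).le
    rw [h2, Complex.norm_real]
    refine le_trans ?_ (le_abs_self _)
    have h3 : ‖triSum n w F G H‖ ≤ ∑ a, ‖Q a‖ := by
      rw [triSum_eq]
      refine norm_sum_le_of_le _ fun a _ => ?_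
      rw [norm_mul]
      exact mul_le_of_le_one_left (norm_nonneg _) (hF a)
    calc ‖triSum n w F G H‖ ^ 2 ≤ (∑ a, ‖Q a‖) ^ 2 := by gcongr
      _ ≤ (∑ a, mm a) * ∑ a, ‖Q a‖ ^ 2 / mm a := by
          refine Finset.sum_sq_le_sum_mul_sum_of_sq_le_mul _ (fun a _ => (hmpos a).le)
            (fun a _ => hnn a) fun a _ => le_of_eq ?_
          have := (hmpos a).ne'
          field_simp
      _ ≤ _ := mul_le_of_le_one_left (Finset.sum_nonneg fun a _ => hnn a) hmsum
  obtain ⟨f, g, hf, hg, h⟩ := hbound F₀ G H hF₀1 hG hH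
  refine ⟨fun x => star (f (fun i => (x i).1)) * F₀ (fun i => (x i).2), fun y => star (g y),
    fun x => ?_, fun y => by rw [norm_star]; exact hg y, ?_⟩
  · rw [norm_mul, norm_star]
    exact mul_le_one₀ (hf _) (norm_nonneg _) (hF₀1 _)
  · rw [pow_mul]
    refine (pow_le_pow_left₀ (by positivity) h1 N).trans (h.trans (le_of_eq ?_))
    -- After conjugation the left end point carries `star F₀ = Q / mm`. Expanding `Q` returns the
    -- trilinear form, with everything else gathered in the dual function.
    rw [← norm_star]
    congr 1
    rw [triSum_eq, labelSum, wordSum, sum_arrow_prod, sum_arrow_prod, star_sum]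
    refine Finset.sum_congr rfl fun y _ => ?_
    rw [dualFun, sum_arrow_prod, star_sum, Finset.sum_mul]
    refine Finset.sum_congr rfl fun u _ => ?_
    rw [star_sum, Finset.sum_mul]
    refine Finset.sum_congr rfl fun a _ => ?_
    have hQF : star (F₀ y) = Q y / mm y := by
      rw [hF₀, star_div₀, star_star]
      simp
    have hprod : ∏ i, star (L (y i, u i) (a i)) / (fstMarginal μ (y i) : ℂ) =
        star (∏ i, L (y i, u i) (a i)) / mm y := by
      rw [Finset.prod_div_distrib, star_prod, hmm]
      push_cast
      rfl
    simp only [star_mul, star_star, hQF, hprod]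
    ring

/-- A dual function with registers: letters `b : Fin k → A` can be stored in the plus letters, in
such a way that the minus letters depend only on the registers which are not read. -/
theorem exists_register_dual [Fintype A] (hw : ∀ a b c, ‖w a b c‖ ≤ μ a b c)
    (hμ : ∑ a, fstMarginal μ a ≤ 1) (hpos : ∀ a, 0 < fstMarginal μ a) [Nonempty A]
    (hsnd : ∀ a a', Relation.TransGen (ShareSnd μ) a a')
    (hthd : ∀ a a', Relation.TransGen (ShareThd μ) a a') (k : ℕ) :
    ∃ (W X Y : Type uA) (_ : Fintype W) (_ : Fintype X) (_ : Fintype Y) (p : W → X) (q : W → Y)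
      (ρ : A → W → ℂ) (v : A → W → ℝ) (N : ℕ) (st : (Fin k → A) → X)
      (wit : (Fin k → A) → Fin k → W),
      (∀ y ω, ‖ρ y ω‖ ≤ v y ω) ∧ (∀ y, ∑ ω, v y ω ≤ 1) ∧
      (∀ b j, Aligned (ρ (b j) (wit b j)) (v (b j) (wit b j)) 1) ∧
      (∀ b j, p (wit b j) = st b) ∧
      (∀ b j y, q (wit (Function.update b j y) j) = q (wit b j)) ∧
      ∀ (n : ℕ) (F : (Fin n → A) → ℂ) (G : (Fin n → B) → ℂ) (H : (Fin n → C) → ℂ),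
        (∀ a, ‖F a‖ ≤ 1) → (∀ b, ‖G b‖ ≤ 1) → (∀ c, ‖H c‖ ≤ 1) →
        ∃ (f : (Fin n → X) → ℂ) (g : (Fin n → Y) → ℂ), (∀ x, ‖f x‖ ≤ 1) ∧ (∀ y, ‖g y‖ ≤ 1) ∧
          ‖triSum n w F G H‖ ^ N ≤ ‖triSum n w (dualFun n ρ p q f g) G H‖ := by
  obtain ⟨U, X, Y, _, _, _, P, M, L, V, N, ι, _, _, up, ux, us, hcard, hL, hreg, hbound⟩ :=
    exists_registers hw hμ hsnd hthd k
  obtain ⟨e⟩ : Nonempty (Fin k ↪ ι) :=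
    Function.Embedding.nonempty_of_card_le (by rw [Fintype.card_fin]; exact hcard.le)
  obtain ⟨t⟩ := ‹Nonempty A›
  -- Surplus registers hold the fixed letter `t`.
  set ext : (Fin k → A) → ι → A := fun b => Function.extend e b (fun _ => t) with hext
  have hext_apply : ∀ b j, ext b (e j) = b j := fun b j => e.injective.extend_apply _ _ _
  have hext_update : ∀ b j y, ext (Function.update b j y) = Function.update (ext b) (e j) y := by
    intro b j y
    funext i
    by_cases hi : ∃ j', e j' = i
    · obtain ⟨j', rfl⟩ := hi
      rw [hext_apply]
      by_cases hj : j' = j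
      · subst hj; simp
      · rw [Function.update_of_ne hj, Function.update_of_ne (e.injective.ne hj), hext_apply]
    · have hne : i ≠ e j := fun h => hi ⟨j, h.symm⟩
      rw [Function.update_of_ne hne]
      simp only [hext]
      rw [Function.extend_apply' _ _ _ hi, Function.extend_apply' _ _ _ hi]
  -- The right end point is counted among the plus letters. Every witness has the fixed letter `t`
  -- there, so the stored value does not reveal which register is read.
  refine ⟨U × A, X × A, Y, inferInstance, inferInstance, inferInstance, fun ω => (P ω.1, ω.2),
    fun ω => M ω.1, fun y ω => star (L (y, ω.1) ω.2) / (fstMarginal μ y : ℂ),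
    fun y ω => V (y, ω.1) ω.2 / fstMarginal μ y, 2 * N, fun b => (P (up (ext b)), t),
    fun b j => (ux (ext b) (e j) t, t), ?_, ?_, ?_, ?_, ?_, ?_⟩
  · intro y ω
    rw [norm_div, norm_star, Complex.norm_real, Real.norm_of_nonneg (hpos y).le]
    exact div_le_div_of_nonneg_right (hL.norm_le _ _) (hpos y).le
  · intro y
    rw [← Finset.sum_div, Fintype.sum_prod_type]
    exact (div_le_one (hpos y)).2 (hL.left y)
  · intro b j
    have := hreg.out (ext b) (e j) t
    rw [hext_apply] at this
    have := this.star.div (hpos (b j))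
    rw [star_one] at this
    exact this
  · intro b j
    exact Prod.ext (hreg.out_plus _ _ _) rfl
  · intro b j y
    simp only
    rw [hext_update, hreg.out_minus]
  · intro n F G H hF hG hH
    exact exists_dualFun_of_labelled hw hμ hpos n (fun F G H => hbound n F G H) F G H hF hG hH

end Gadget

/-! ### Embeddings from integral relations -/

/-- A homomorphism to a divisible group extends along any homomorphism whose kernel it kills. -/
theorem exists_comp_eq_of_ker_le {L M Q : Type*} [AddCommGroup L] [AddCommGroup M] [AddCommGroup Q]
    [DivisibleBy Q ℤ] (φ : L →+ M) (ψ : L →+ Q) (h : ∀ n, φ n = 0 → ψ n = 0) :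
    ∃ θ : M →+ Q, ∀ n, θ (φ n) = ψ n := by
  obtain ⟨θ, hθ⟩ := (Module.Baer.of_divisible Q).extension_property_addMonoidHom
    (QuotientAddGroup.kerLift φ) (QuotientAddGroup.kerLift_injective φ)
    (QuotientAddGroup.lift φ.ker ψ fun n hn => h n hn)
  exact ⟨θ, fun n => DFunLike.congr_fun hθ (n : L ⧸ φ.ker)⟩

noncomputable instance : DivisibleBy (Additive Circle) ℤ :=
  Function.Surjective.divisibleBy (A := ℝ) (fun x => Additive.ofMul (Circle.exp x))
    (fun z => ⟨Complex.arg (z.toMul : ℂ), congrArg Additive.ofMul (Circle.exp_arg z.toMul)⟩)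
    (fun a n => by
      have h : ∀ (m : ℤ) (x : ℝ), Circle.expHom (m • x) = m • Circle.expHom x := fun m x =>
        map_zsmul Circle.expHom m x
      exact h n a)

/-- The sums of an integer-valued function over the fibres of `u`. -/
def fibreSum {E Z : Type*} [Fintype E] [DecidableEq Z] (u : E → Z) : (E → ℤ) →+ (Z → ℤ) :=
  AddMonoidHom.mk' (fun n s => ∑ e, if u e = s then n e else 0) fun n n' => by
    funext s
    simp only [Pi.add_apply, ← Finset.sum_add_distrib]
    exact Finset.sum_congr rfl fun e _ => by split_ifs <;> simp

theorem fibreSum_single {E Z : Type*} [Fintype E] [DecidableEq E] [DecidableEq Z] (u : E → Z)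
    (e : E) : fibreSum u (Pi.single e 1) = Pi.single (u e) 1 := by
  funext s
  change ∑ e', (if u e' = s then (Pi.single e (1 : ℤ) : E → ℤ) e' else 0) = _
  rw [Finset.sum_eq_single e (fun e' _ he' => by simp [he']) (by simp)]
  simp [Pi.single_apply, eq_comm]

/-- Splitting into positive and negative parts turns an integral relation into two families of
multiplicities. -/
theorem sum_toNat_eq_of_fibreSum_eq_zero {E Z : Type*} [Fintype E] [DecidableEq Z] (u : E → Z)
    (n : E → ℤ) (hn : fibreSum u n = 0) (s : Z) :
    ∑ e, (if u e = s then (n e).toNat else 0) = ∑ e, if u e = s then (-n e).toNat else 0 := by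
  have h1 : ∑ e, (if u e = s then n e else 0) = 0 := congrFun hn s
  have h2 : ∀ e, (if u e = s then n e else 0) =
      ((if u e = s then (n e).toNat else 0 : ℕ) : ℤ) -
        ((if u e = s then (-n e).toNat else 0 : ℕ) : ℤ) := by
    intro e
    split_ifs <;> omega
  simp only [h2, Finset.sum_sub_distrib] at h1
  exact_mod_cast sub_eq_zero.1 h1

/-- A circle-valued function on triples is a product of functions of the coordinates, as soon as it
is multiplicatively trivial on the integral relations between the triples. -/
theorem exists_embedding_of_relations {E S G P : Type*} [Fintype E] [DecidableEq S] [DecidableEq G]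
    [DecidableEq P] (x : E → S) (y : E → G) (z : E → P) (t : E → Circle)
    (h : ∀ c d : E → ℕ,
      (∀ s, ∑ e, (if x e = s then c e else 0) = ∑ e, if x e = s then d e else 0) →
      (∀ s, ∑ e, (if y e = s then c e else 0) = ∑ e, if y e = s then d e else 0) →
      (∀ s, ∑ e, (if z e = s then c e else 0) = ∑ e, if z e = s then d e else 0) →
      ∏ e, t e ^ c e = ∏ e, t e ^ d e) :
    ∃ (A : S → Circle) (B : G → Circle) (C : P → Circle),
      ∀ e, A (x e) * B (y e) * C (z e) * t e = 1 := by
  classical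
  let ψ : (E → ℤ) →+ Additive Circle :=
    AddMonoidHom.mk' (fun n => Additive.ofMul (∏ e, t e ^ n e)) fun n n' => by
      rw [← ofMul_mul, ← Finset.prod_mul_distrib]
      simp only [Pi.add_apply, zpow_add]
  obtain ⟨θ, hθ⟩ := exists_comp_eq_of_ker_le
    ((fibreSum x).prod ((fibreSum y).prod (fibreSum z))) ψ (fun n hn => by
      simp only [AddMonoidHom.prod_apply, Prod.mk_eq_zero] at hn
      have h1 := h _ _ (sum_toNat_eq_of_fibreSum_eq_zero x n hn.1)
        (sum_toNat_eq_of_fibreSum_eq_zero y n hn.2.1)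
        (sum_toNat_eq_of_fibreSum_eq_zero z n hn.2.2)
      have h2 : ∀ e, t e ^ n e = t e ^ (n e).toNat / t e ^ (-n e).toNat := by
        intro e
        rw [← zpow_natCast, ← zpow_natCast, div_eq_mul_inv, ← zpow_sub]
        congr 1
        omega
      change Additive.ofMul (∏ e, t e ^ n e) = 0
      rw [Finset.prod_congr rfl fun e _ => h2 e, Finset.prod_div_distrib, h1, div_self']
      rfl)
  refine ⟨fun s => (θ (Pi.single s 1, 0, 0)).toMul⁻¹, fun s => (θ (0, Pi.single s 1, 0)).toMul⁻¹,
    fun s => (θ (0, 0, Pi.single s 1)).toMul⁻¹, fun e => ?_⟩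
  have h1 := hθ (Pi.single e 1)
  have h2 : ψ (Pi.single e 1) = Additive.ofMul (t e) := by
    change Additive.ofMul (∏ e', t e' ^ (Pi.single e (1 : ℤ) : E → ℤ) e') = _
    rw [Finset.prod_eq_single e (fun e' _ he' => by simp [he']) (by simp)]
    simp
  have h3 : ((Pi.single (x e) 1, Pi.single (y e) 1, Pi.single (z e) 1) :
      (S → ℤ) × (G → ℤ) × (P → ℤ)) =
      (Pi.single (x e) 1, 0, 0) + (0, Pi.single (y e) 1, 0) + (0, 0, Pi.single (z e) 1) := by
    simp
  rw [h2, AddMonoidHom.prod_apply, AddMonoidHom.prod_apply, fibreSum_single, fibreSum_single,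
    fibreSum_single, h3, map_add, map_add] at h1
  have h4 : t e = (θ (Pi.single (x e) 1, 0, 0)).toMul * (θ (0, Pi.single (y e) 1, 0)).toMul *
      (θ (0, 0, Pi.single (z e) 1)).toMul := congrArg Additive.toMul h1.symm
  rw [h4, ← mul_inv, ← mul_inv, inv_mul_cancel]

theorem card_sigma_fibre {E Z : Type*} [Fintype E] [DecidableEq Z] (u : E → Z) (c : E → ℕ) (s : Z) :
    Fintype.card {i : Σ e, Fin (c e) // u i.1 = s} = ∑ e, if u e = s then c e else 0 := by
  rw [Fintype.card_subtype, Finset.card_filter, Fintype.sum_sigma]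
  exact Finset.sum_congr rfl fun e _ => by split_ifs <;> simp

/-- Families of elements with multiplicities `c` and `d` have matching images under `u` if the
fibre sums of `c` and `d` agree. -/
theorem exists_equiv_of_fibre_sums {E Z : Type*} [Fintype E] [DecidableEq Z] (u : E → Z)
    (c d : E → ℕ)
    (h : ∀ s, ∑ e, (if u e = s then c e else 0) = ∑ e, if u e = s then d e else 0) :
    ∃ σ : (Σ e, Fin (c e)) ≃ Σ e, Fin (d e), ∀ i, u (σ i).1 = u i.1 := by
  have e : ∀ s, {i : Σ e, Fin (c e) // u i.1 = s} ≃ {i : Σ e, Fin (d e) // u i.1 = s} := fun s =>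
    Fintype.equivOfCardEq (by rw [card_sigma_fibre, card_sigma_fibre, h])
  exact ⟨Equiv.ofFiberEquiv (f := fun i : Σ e, Fin (c e) => u i.1)
    (g := fun i : Σ e, Fin (d e) => u i.1) e, fun i => Equiv.ofFiberEquiv_map
      (f := fun i : Σ e, Fin (c e) => u i.1) (g := fun i : Σ e, Fin (d e) => u i.1) e i⟩

/-- The multiplicative relations between triples with multiplicities follow from those between
families of triples with permuted coordinates. -/
theorem prod_pow_eq_of_relations {E S G P M : Type*} [Fintype E] [DecidableEq S] [DecidableEq G]
    [DecidableEq P] [CommMonoid M] (x : E → S) (y : E → G) (z : E → P) (t : E → M)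
    (h : ∀ (k : ℕ) (p q : Fin k → E) (τ ρ : Equiv.Perm (Fin k)), (∀ i, x (p i) = x (q i)) →
      (∀ i, y (p i) = y (q (τ i))) → (∀ i, z (p i) = z (q (ρ i))) →
      ∏ i, t (p i) = ∏ i, t (q i)) (c d : E → ℕ)
    (hx : ∀ s, ∑ e, (if x e = s then c e else 0) = ∑ e, if x e = s then d e else 0)
    (hy : ∀ s, ∑ e, (if y e = s then c e else 0) = ∑ e, if y e = s then d e else 0)
    (hz : ∀ s, ∑ e, (if z e = s then c e else 0) = ∑ e, if z e = s then d e else 0) :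
    ∏ e, t e ^ c e = ∏ e, t e ^ d e := by
  obtain ⟨ex, hex⟩ := exists_equiv_of_fibre_sums x c d hx
  obtain ⟨ey, hey⟩ := exists_equiv_of_fibre_sums y c d hy
  obtain ⟨ez, hez⟩ := exists_equiv_of_fibre_sums z c d hz
  let e₀ : Fin (Fintype.card (Σ e, Fin (c e))) ≃ Σ e, Fin (c e) := (Fintype.equivFin _).symm
  have key : ∀ m : E → ℕ, ∏ i : (Σ e, Fin (m e)), t i.1 = ∏ e, t e ^ m e := by
    intro m
    rw [Fintype.prod_sigma]
    simp
  -- The second family is ordered through `ex`, so first coordinates match without a permutation;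
  -- the other two matchings are expressed relative to this order.
  have h1 := h _ (fun i => (e₀ i).1) (fun i => (ex (e₀ i)).1)
    (((e₀.trans ey).trans ex.symm).trans e₀.symm) (((e₀.trans ez).trans ex.symm).trans e₀.symm)
    (fun i => (hex _).symm) (fun i => by simp [hey]) (fun i => by simp [hez])
  rw [← key, ← key, ← e₀.prod_comp, ← (e₀.trans ex).prod_comp]
  exact h1

/-! ### Functions that transform by the values of `T` -/

/-- `a` transforms by the values of `T` if an entry of each of its three words is replaced, such
that both the old and the new triple of entries satisfy `R`. -/
def Replaces {ι S G P : Type*} [DecidableEq ι] (R : S → G → P → Prop) (T : S → G → P → ℂ)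
    (a : (ι → S) → (ι → G) → (ι → P) → ℂ) : Prop :=
  ∀ bx bY bz i j l x y z, R (bx i) (bY j) (bz l) → R x y z →
    T (bx i) (bY j) (bz l) *
      a (Function.update bx i x) (Function.update bY j y) (Function.update bz l z) =
        a bx bY bz * T x y z

/-- A transposition is two replacements, between the same two support triples in opposite
directions, and their factors cancel. -/
theorem Replaces.comp_perm {ι S G P : Type*} [DecidableEq ι] [Finite ι] {R : S → G → P → Prop}
    {T : S → G → P → ℂ} {a : (ι → S) → (ι → G) → (ι → P) → ℂ} (ha : Replaces R T a)
    (hT : ∀ x y z, R x y z → T x y z ≠ 0) {bx : ι → S} {bY : ι → G} {bz : ι → P}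
    (hb : ∀ i, ∃ j l, R (bx i) (bY j) (bz l)) (σ : Equiv.Perm ι) :
    a (fun i => bx (σ i)) bY bz = a bx bY bz := by
  induction σ using Equiv.Perm.swap_induction_on' with
  | one => rfl
  | mul_swap σ i i' hii' ih =>
    rw [← ih]
    obtain ⟨j, l, h⟩ := hb (σ i)
    obtain ⟨j', l', h'⟩ := hb (σ i')
    -- The first replacement writes the triple of `σ i'` at positions `i`, `j`, `l`; the second
    -- restores `j` and `l` and writes the displaced letter at `i'`.
    have h1 := ha (fun i => bx (σ i)) bY bz i j l _ _ _ h h'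
    have h2 := ha (Function.update (fun i => bx (σ i)) i (bx (σ i'))) (Function.update bY j (bY j'))
      (Function.update bz l (bz l')) i' j l _ _ _ (by simpa [hii'.symm] using h') h
    simp only [Function.update_idem, Function.update_eq_self, Function.update_self,
      Function.update_of_ne hii'.symm] at h2
    have h3 : Function.update (Function.update (fun i => bx (σ i)) i (bx (σ i'))) i' (bx (σ i)) =
        fun m => bx ((σ * Equiv.swap i i') m) := by
      funext m
      rcases eq_or_ne m i' with rfl | hm'
      · simp
      · rcases eq_or_ne m i with rfl | hm
        · simp [hm']
        · simp [hm, hm', Equiv.swap_apply_of_ne_of_ne]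
    rw [h3] at h2
    have h4 := hT _ _ _ h
    have h5 := hT _ _ _ h'
    refine mul_left_cancel₀ (mul_ne_zero h4 h5) ?_
    linear_combination T (bx (σ i)) (bY j) (bz l) * h2 + T (bx (σ i)) (bY j) (bz l) * h1

/-- The triples are replaced one position at a time, and the factors multiply. -/
theorem Replaces.prod {ι S G P : Type*} [DecidableEq ι] {R : S → G → P → Prop}
    {T : S → G → P → ℂ} {a : (ι → S) → (ι → G) → (ι → P) → ℂ} (ha : Replaces R T a)
    {px qx : ι → S} {py qy : ι → G} {pz qz : ι → P} (hp : ∀ i, R (px i) (py i) (pz i))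
    (hq : ∀ i, R (qx i) (qy i) (qz i)) (s : Finset ι) :
    (∏ i ∈ s, T (px i) (py i) (pz i)) *
      a (s.piecewise qx px) (s.piecewise qy py) (s.piecewise qz pz) =
        a px py pz * ∏ i ∈ s, T (qx i) (qy i) (qz i) := by
  induction s using Finset.induction_on with
  | empty => simp
  | insert j s hj ih =>
    have h := ha (s.piecewise qx px) (s.piecewise qy py) (s.piecewise qz pz) j j j _ _ _
      (by simpa [hj] using hp j) (hq j)
    simp only [Finset.piecewise_eq_of_notMem _ _ _ hj] at h
    rw [Finset.piecewise_insert, Finset.piecewise_insert, Finset.piecewise_insert,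
      Finset.prod_insert hj, Finset.prod_insert hj]
    linear_combination (∏ i ∈ s, T (px i) (py i) (pz i)) * h + T (qx j) (qy j) (qz j) * ih

/-- The products of `T` over two families of triples with permuted coordinates agree. -/
theorem Replaces.prod_eq {ι S G P : Type*} [DecidableEq ι] [Fintype ι] {R : S → G → P → Prop}
    {T : S → G → P → ℂ} {a : (ι → S) → (ι → G) → (ι → P) → ℂ} (ha : Replaces R T a)
    (hT : ∀ x y z, R x y z → T x y z ≠ 0) (ha0 : ∀ bx bY bz, a bx bY bz ≠ 0)
    {px qx : ι → S} {py qy : ι → G} {pz qz : ι → P} (hp : ∀ i, R (px i) (py i) (pz i))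
    (hq : ∀ i, R (qx i) (qy i) (qz i)) (τ ρ : Equiv.Perm ι) (hx : ∀ i, px i = qx i)
    (hy : ∀ i, py i = qy (τ i)) (hz : ∀ i, pz i = qz (ρ i)) :
    ∏ i, T (px i) (py i) (pz i) = ∏ i, T (qx i) (qy i) (qz i) := by
  have h := ha.prod hp hq Finset.univ
  obtain rfl : px = qx := funext hx
  obtain rfl : py = fun i => qy (τ i) := funext hy
  obtain rfl : pz = fun i => qz (ρ i) := funext hz
  have h1 : a px (fun i => qy (τ i)) qz = a px qy qz :=
    Replaces.comp_perm (R := fun y x z => R x y z) (T := fun y x z => T x y z)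
      (a := fun y x z => a x y z) (fun bx bY bz i j l x y z h h' => ha bY bx bz j i l y x z h h')
      (fun y x z => hT x y z) (fun i => ⟨i, i, hq i⟩) τ
  have h2 : a px (fun i => qy (τ i)) (fun i => qz (ρ i)) = a px (fun i => qy (τ i)) qz :=
    Replaces.comp_perm (R := fun z x y => R x y z) (T := fun z x y => T x y z)
      (a := fun z x y => a x y z) (fun bx bY bz i j l x y z h h' => ha bY bz bx j l i y z x h h')
      (fun z x y => hT x y z) (fun i => ⟨i, τ.symm i, by simpa using hq i⟩) ρ
  simp only [Finset.piecewise_univ] at h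
  rw [h2, h1, mul_comm] at h
  exact mul_left_cancel₀ (ha0 _ _ _) h

/-! ### Connectivity of bipartite graphs -/

theorem bipartiteGraph_flip_connected {α β : Type*} {R : α → β → Prop}
    (h : (bipartiteGraph R).Connected) : (bipartiteGraph fun b a => R a b).Connected := by
  have e : bipartiteGraph R ≃g bipartiteGraph fun b a => R a b :=
    { Equiv.sumComm α β with
      map_rel_iff' := by
        rintro (a | a) (b | b) <;> simp [bipartiteGraph] }
  exact e.connected_iff.1 h

theorem reflTransGen_of_bipartiteGraph_reachable {α β : Type*} {R : α → β → Prop} {a : α}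
    {u : α ⊕ β} (h : (bipartiteGraph R).Reachable (Sum.inl a) u) :
    (∀ a', u = Sum.inl a' → Relation.ReflTransGen (fun a a' => ∃ b, R a b ∧ R a' b) a a') ∧
    ∀ b, u = Sum.inr b →
      ∃ a', Relation.ReflTransGen (fun a a' => ∃ b, R a b ∧ R a' b) a a' ∧ R a' b := by
  rw [SimpleGraph.reachable_iff_reflTransGen] at h
  induction h with
  | refl => exact ⟨fun a' h => by cases h; exact .refl, fun b h => by cases h⟩
  | tail _ h ih =>
    rw [bipartiteGraph, SimpleGraph.fromRel_adj] at h
    obtain ⟨-, ⟨a₁, b₁, rfl, rfl, hR⟩ | ⟨a₁, b₁, rfl, rfl, hR⟩⟩ := h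
    · exact ⟨fun a' h => (by cases h), fun b h => by cases h; exact ⟨a₁, ih.1 a₁ rfl, hR⟩⟩
    · obtain ⟨a₂, h₂, hR₂⟩ := ih.2 b₁ rfl
      exact ⟨fun a' h => by cases h; exact h₂.tail ⟨b₁, hR₂, hR⟩, fun b h => by cases h⟩

theorem exists_of_bipartiteGraph_connected {α β : Type*} [hβ : Nonempty β] {R : α → β → Prop}
    (h : (bipartiteGraph R).Connected) (a : α) : ∃ b, R a b := by
  obtain ⟨b⟩ := hβ
  obtain ⟨a', h', hR⟩ :=
      (reflTransGen_of_bipartiteGraph_reachable (h (Sum.inl a) (Sum.inr b))).2 b rfl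
  obtain rfl | ⟨c, ⟨b', h1, -⟩, -⟩ := h'.cases_head
  · exact ⟨b, hR⟩
  · exact ⟨b', h1⟩

theorem transGen_of_bipartiteGraph_connected {α β : Type*} [Nonempty β] {R : α → β → Prop}
    (h : (bipartiteGraph R).Connected) (a a' : α) :
    Relation.TransGen (fun a a' => ∃ b, R a b ∧ R a' b) a a' := by
  obtain ⟨b, hb⟩ := exists_of_bipartiteGraph_connected h a
  exact Relation.TransGen.trans_left (.single ⟨b, hb, hb⟩)
    ((reflTransGen_of_bipartiteGraph_reachable (h (Sum.inl a) (Sum.inl a'))).1 a' rfl)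

/-! ### The bilinear form in plus and minus letters -/

/-- The pushforward of a family of masses keeps the total mass. -/
theorem sum_pushWeight {Ω Z M : Type*} [Fintype Ω] [Fintype Z] [DecidableEq Z] [AddCommMonoid M]
    (π : Ω → Z) (v : Ω → M) : ∑ z, pushWeight π v z = ∑ ω, v ω := by
  simp only [pushWeight]
  rw [Finset.sum_comm]
  simp

theorem norm_pushWeight_le {Ω Z : Type*} [Fintype Ω] [DecidableEq Z] (π : Ω → Z)
    {w : Ω → ℂ} {v : Ω → ℝ} (h : ∀ ω, ‖w ω‖ ≤ v ω) (z : Z) :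
    ‖pushWeight π w z‖ ≤ pushWeight π v z :=
  norm_sum_le_of_le _ fun ω _ => by split_ifs <;> simp [h]

theorem Aligned.pushWeight {Ω Z : Type*} [Fintype Ω] [DecidableEq Z] {π : Ω → Z}
    {w : Ω → ℂ} {v : Ω → ℝ} (h : ∀ ω, ‖w ω‖ ≤ v ω) {ω : Ω} {θ : ℂ} (hω : Aligned (w ω) (v ω) θ) :
    Aligned (pushWeight π w (π ω)) (pushWeight π v (π ω)) θ :=
  Aligned.sum (fun ω _ => by split_ifs <;> simp [h]) (Finset.mem_univ ω) (by simpa using hω)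

/-- A mass on triples for which the first alphabet is connected through each of the other two. -/
structure IsLinked {A B C : Type*} [Fintype A] [Fintype B] [Fintype C] (μ : A → B → C → ℝ) :
    Prop where
  sum_le : ∑ a, fstMarginal μ a ≤ 1
  pos : ∀ a, 0 < fstMarginal μ a
  snd : ∀ a a', Relation.TransGen (ShareSnd μ) a a'
  thd : ∀ a a', Relation.TransGen (ShareThd μ) a a'

theorem triSum_swap {A B C : Type*} [Fintype A] [Fintype B] [Fintype C] (n : ℕ)
    (w : A → B → C → ℂ) (F : (Fin n → A) → ℂ) (G : (Fin n → B) → ℂ) (H : (Fin n → C) → ℂ) :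
    triSum n (fun b a c => w a b c) G F H = triSum n w F G H := by
  rw [triSum, triSum, Finset.sum_comm]
  simp only [mul_comm (G _)]

theorem triSum_rotate {A B C : Type*} [Fintype A] [Fintype B] [Fintype C] (n : ℕ)
    (w : A → B → C → ℂ) (F : (Fin n → A) → ℂ) (G : (Fin n → B) → ℂ) (H : (Fin n → C) → ℂ) :
    triSum n (fun c a b => w a b c) H F G = triSum n w F G H := by
  rw [triSum, triSum, Finset.sum_comm]
  refine Finset.sum_congr rfl fun a _ => ?_
  rw [Finset.sum_comm]
  refine Finset.sum_congr rfl fun b _ => Finset.sum_congr rfl fun c _ => ?_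
  ring

/-- The combination of a kernel on triples with three kernels for its coordinates. -/
def tripleKernel {A B C W₁ W₂ W₃ M : Type*} [Mul M] (w : A → B → C → M) (ρ₁ : A → W₁ → M)
    (ρ₂ : B → W₂ → M) (ρ₃ : C → W₃ → M) (ω : (A × B × C) × W₁ × W₂ × W₃) : M :=
  w ω.1.1 ω.1.2.1 ω.1.2.2 * (ρ₁ ω.1.1 ω.2.1 * (ρ₂ ω.1.2.1 ω.2.2.1 * ρ₃ ω.1.2.2 ω.2.2.2))

theorem triSum_dualFun {A B C W₁ W₂ W₃ X₁ X₂ X₃ Y₁ Y₂ Y₃ : Type*} [Fintype A] [Fintype B]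
    [Fintype C] [Fintype W₁] [Fintype W₂] [Fintype W₃] (n : ℕ) (w : A → B → C → ℂ)
    (ρ₁ : A → W₁ → ℂ) (ρ₂ : B → W₂ → ℂ) (ρ₃ : C → W₃ → ℂ) (p₁ : W₁ → X₁) (p₂ : W₂ → X₂)
    (p₃ : W₃ → X₃) (q₁ : W₁ → Y₁) (q₂ : W₂ → Y₂) (q₃ : W₃ → Y₃) (f₁ : (Fin n → X₁) → ℂ)
    (f₂ : (Fin n → X₂) → ℂ) (f₃ : (Fin n → X₃) → ℂ) (g₁ : (Fin n → Y₁) → ℂ)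
    (g₂ : (Fin n → Y₂) → ℂ) (g₃ : (Fin n → Y₃) → ℂ) :
    triSum n w (dualFun n ρ₁ p₁ q₁ f₁ g₁) (dualFun n ρ₂ p₂ q₂ f₂ g₂) (dualFun n ρ₃ p₃ q₃ f₃ g₃) =
      wordSum n (tripleKernel w ρ₁ ρ₂ ρ₃) (fun ω =>
        (f₁ (fun i => p₁ (ω i).2.1) * f₂ (fun i => p₂ (ω i).2.2.1) * f₃ (fun i => p₃ (ω i).2.2.2)) *
        (g₁ (fun i => q₁ (ω i).2.1) * g₂ (fun i => q₂ (ω i).2.2.1) *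
          g₃ (fun i => q₃ (ω i).2.2.2))) := by
  rw [wordSum, sum_arrow_prod, sum_arrow_prod, triSum]
  refine Finset.sum_congr rfl fun a _ => ?_
  rw [sum_arrow_prod]
  refine Finset.sum_congr rfl fun b _ => Finset.sum_congr rfl fun c _ => ?_
  rw [sum_arrow_prod]
  simp only [dualFun]
  rw [mul_assoc, Finset.sum_mul_sum, Finset.sum_mul_sum, Finset.mul_sum]
  refine Finset.sum_congr rfl fun ω₁ _ => ?_
  rw [sum_arrow_prod, Finset.mul_sum]
  refine Finset.sum_congr rfl fun ω₂ _ => ?_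
  rw [Finset.mul_sum, Finset.mul_sum]
  refine Finset.sum_congr rfl fun ω₃ _ => ?_
  simp only [tripleKernel, Finset.prod_mul_distrib]
  ring

/-- The two points of the bilinear form attached to a triple of registers. -/
def tripleMap {V W₁ W₂ W₃ X₁ X₂ X₃ Y₁ Y₂ Y₃ : Type*} (p₁ : W₁ → X₁) (p₂ : W₂ → X₂)
    (p₃ : W₃ → X₃) (q₁ : W₁ → Y₁) (q₂ : W₂ → Y₂) (q₃ : W₃ → Y₃) (ω : V × W₁ × W₂ × W₃) :
    (X₁ × X₂ × X₃) × Y₁ × Y₂ × Y₃ :=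
  ((p₁ ω.2.1, p₂ ω.2.2.1, p₃ ω.2.2.2), (q₁ ω.2.1, q₂ ω.2.2.1, q₃ ω.2.2.2))

theorem triSum_dualFun_push {A B C W₁ W₂ W₃ X₁ X₂ X₃ Y₁ Y₂ Y₃ : Type*} [Fintype A] [Fintype B]
    [Fintype C] [Fintype W₁] [Fintype W₂] [Fintype W₃]
    [Fintype X₁] [Fintype X₂] [Fintype X₃] [Fintype Y₁] [Fintype Y₂] [Fintype Y₃]
    [DecidableEq ((X₁ × X₂ × X₃) × Y₁ × Y₂ × Y₃)] (n : ℕ) (w : A → B → C → ℂ)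
    (ρ₁ : A → W₁ → ℂ) (ρ₂ : B → W₂ → ℂ) (ρ₃ : C → W₃ → ℂ) (p₁ : W₁ → X₁) (p₂ : W₂ → X₂)
    (p₃ : W₃ → X₃) (q₁ : W₁ → Y₁) (q₂ : W₂ → Y₂) (q₃ : W₃ → Y₃) (f₁ : (Fin n → X₁) → ℂ)
    (f₂ : (Fin n → X₂) → ℂ) (f₃ : (Fin n → X₃) → ℂ) (g₁ : (Fin n → Y₁) → ℂ)
    (g₂ : (Fin n → Y₂) → ℂ) (g₃ : (Fin n → Y₃) → ℂ) :
    triSum n w (dualFun n ρ₁ p₁ q₁ f₁ g₁) (dualFun n ρ₂ p₂ q₂ f₂ g₂) (dualFun n ρ₃ p₃ q₃ f₃ g₃) =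
      wordSum n (fun z : (X₁ × X₂ × X₃) × Y₁ × Y₂ × Y₃ =>
        pushWeight (tripleMap p₁ p₂ p₃ q₁ q₂ q₃) (tripleKernel w ρ₁ ρ₂ ρ₃) (z.1, z.2)) (fun z =>
        (f₁ (fun i => (z i).1.1) * f₂ (fun i => (z i).1.2.1) * f₃ (fun i => (z i).1.2.2)) *
        (g₁ (fun i => (z i).2.1) * g₂ (fun i => (z i).2.2.1) * g₃ (fun i => (z i).2.2.2))) :=
  (triSum_dualFun n w ρ₁ ρ₂ ρ₃ p₁ p₂ p₃ q₁ q₂ q₃ f₁ f₂ f₃ g₁ g₂ g₃).trans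
    (wordSum_push n (tripleMap p₁ p₂ p₃ q₁ q₂ q₃) (tripleKernel w ρ₁ ρ₂ ρ₃) (fun z =>
      (f₁ (fun i => (z i).1.1) * f₂ (fun i => (z i).1.2.1) * f₃ (fun i => (z i).1.2.2)) *
      (g₁ (fun i => (z i).2.1) * g₂ (fun i => (z i).2.2.1) * g₃ (fun i => (z i).2.2.2))))

section TripleKernel

variable {A B C W₁ W₂ W₃ : Type*} {w : A → B → C → ℂ} {μ : A → B → C → ℝ} {ρ₁ : A → W₁ → ℂ}
  {ρ₂ : B → W₂ → ℂ} {ρ₃ : C → W₃ → ℂ} {v₁ : A → W₁ → ℝ} {v₂ : B → W₂ → ℝ} {v₃ : C → W₃ → ℝ}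

theorem norm_tripleKernel_le (hw : ∀ a b c, ‖w a b c‖ ≤ μ a b c) (h₁ : ∀ y ω, ‖ρ₁ y ω‖ ≤ v₁ y ω)
    (h₂ : ∀ y ω, ‖ρ₂ y ω‖ ≤ v₂ y ω) (h₃ : ∀ y ω, ‖ρ₃ y ω‖ ≤ v₃ y ω)
    (ω : (A × B × C) × W₁ × W₂ × W₃) :
    ‖tripleKernel w ρ₁ ρ₂ ρ₃ ω‖ ≤ tripleKernel μ v₁ v₂ v₃ ω := by
  simp only [tripleKernel, norm_mul]
  have h4 := (norm_nonneg _).trans (hw ω.1.1 ω.1.2.1 ω.1.2.2)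
  have h5 := (norm_nonneg _).trans (h₁ ω.1.1 ω.2.1)
  have h6 := (norm_nonneg _).trans (h₂ ω.1.2.1 ω.2.2.1)
  gcongr
  exacts [hw _ _ _, h₁ _ _, h₂ _ _, h₃ _ _]

theorem sum_tripleKernel_le [Fintype A] [Fintype B] [Fintype C] [Fintype W₁] [Fintype W₂]
    [Fintype W₃] (hμ : ∀ a b c, 0 ≤ μ a b c) (hsum : ∑ a, ∑ b, ∑ c, μ a b c ≤ 1)
    (h₂ : ∀ y ω, 0 ≤ v₂ y ω) (h₃ : ∀ y ω, 0 ≤ v₃ y ω) (hv₁ : ∀ y, ∑ ω, v₁ y ω ≤ 1)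
    (hv₂ : ∀ y, ∑ ω, v₂ y ω ≤ 1) (hv₃ : ∀ y, ∑ ω, v₃ y ω ≤ 1) :
    ∑ ω, tripleKernel μ v₁ v₂ v₃ ω ≤ 1 := by
  refine le_trans ?_ hsum
  simp only [Fintype.sum_prod_type, tripleKernel, ← Finset.mul_sum, ← Finset.sum_mul]
  refine Finset.sum_le_sum fun a _ => Finset.sum_le_sum fun b _ => Finset.sum_le_sum fun c _ => ?_
  refine mul_le_of_le_one_right (hμ _ _ _) ?_
  exact mul_le_one₀ (hv₁ _) (mul_nonneg (Finset.sum_nonneg fun ω _ => h₂ _ ω)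
    (Finset.sum_nonneg fun ω _ => h₃ _ ω)) (mul_le_one₀ (hv₂ _)
      (Finset.sum_nonneg fun ω _ => h₃ _ ω) (hv₃ _))

theorem aligned_tripleKernel (hw : ∀ a b c, ‖w a b c‖ ≤ μ a b c)
    (h₁ : ∀ y ω, ‖ρ₁ y ω‖ ≤ v₁ y ω) (h₂ : ∀ y ω, ‖ρ₂ y ω‖ ≤ v₂ y ω)
    (h₃ : ∀ y ω, ‖ρ₃ y ω‖ ≤ v₃ y ω) {ω : (A × B × C) × W₁ × W₂ × W₃} {θ : ℂ}
    (hθ : Aligned (w ω.1.1 ω.1.2.1 ω.1.2.2) (μ ω.1.1 ω.1.2.1 ω.1.2.2) θ)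
    (ha₁ : Aligned (ρ₁ ω.1.1 ω.2.1) (v₁ ω.1.1 ω.2.1) 1)
    (ha₂ : Aligned (ρ₂ ω.1.2.1 ω.2.2.1) (v₂ ω.1.2.1 ω.2.2.1) 1)
    (ha₃ : Aligned (ρ₃ ω.1.2.2 ω.2.2.2) (v₃ ω.1.2.2 ω.2.2.2) 1) :
    Aligned (tripleKernel w ρ₁ ρ₂ ρ₃ ω) (tripleKernel μ v₁ v₂ v₃ ω) θ := by
  have h5 := ha₂.mul (h₂ _ _) (h₃ _ _) ha₃
  have h6 : ‖ρ₂ ω.1.2.1 ω.2.2.1 * ρ₃ ω.1.2.2 ω.2.2.2‖ ≤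
      v₂ ω.1.2.1 ω.2.2.1 * v₃ ω.1.2.2 ω.2.2.2 := by
    rw [norm_mul]
    exact mul_le_mul (h₂ _ _) (h₃ _ _) (norm_nonneg _) ha₂.1.le
  have h7 := ha₁.mul (h₁ _ _) h6 h5
  have h8 := hθ.mul (hw _ _ _) (by
    rw [norm_mul]
    exact mul_le_mul (h₁ _ _) h6 (norm_nonneg _) ha₁.1.le) h7
  rw [mul_one, mul_one, mul_one] at h8
  exact h8

end TripleKernel

section Relations

variable {A : Type uA} {B : Type uB} {C : Type uC} [Fintype A] [Fintype B] [Fintype C]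
  {w : A → B → C → ℂ} {μ : A → B → C → ℝ} {T : A → B → C → ℂ}

/-- Either the trilinear forms decay exponentially, or there is a unimodular function on triples of
words that transforms by the values of `T` when entries are replaced. -/
theorem decay_or_replaces [Nonempty A] [Nonempty B] [Nonempty C] (h₁ : IsLinked μ)
    (h₂ : IsLinked fun b a c => μ a b c) (h₃ : IsLinked fun c a b => μ a b c)
    (hw : ∀ a b c, w a b c = μ a b c * T a b c) (hμ : ∀ a b c, 0 ≤ μ a b c)
    (hT : ∀ a b c, 0 < μ a b c → ‖T a b c‖ = 1) (k : ℕ) :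
    (∃ (N : ℕ) (r : ℝ), r < 1 ∧ ∀ (n : ℕ) (F : (Fin n → A) → ℂ) (G : (Fin n → B) → ℂ)
      (H : (Fin n → C) → ℂ), (∀ a, ‖F a‖ ≤ 1) → (∀ b, ‖G b‖ ≤ 1) → (∀ c, ‖H c‖ ≤ 1) →
        ‖triSum n w F G H‖ ^ N ≤ r ^ n) ∨
    ∃ a : (Fin k → A) → (Fin k → B) → (Fin k → C) → ℂ, (∀ bx bY bz, ‖a bx bY bz‖ = 1) ∧
      Replaces (fun a b c => 0 < μ a b c) T a := by
  classical
  have hwμ : ∀ a b c, ‖w a b c‖ ≤ μ a b c := by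
    intro a b c
    rw [hw, norm_mul, Complex.norm_real, Real.norm_of_nonneg (hμ a b c)]
    rcases (hμ a b c).eq_or_lt with h | h
    · simp [← h]
    · rw [hT a b c h, mul_one]
  have hwT : ∀ a b c, 0 < μ a b c → Aligned (w a b c) (μ a b c) (T a b c) := fun a b c h =>
    ⟨h, fun _ => hw a b c⟩
  obtain ⟨W₁, X₁, Y₁, _, _, _, p₁, q₁, ρ₁, v₁, N₁, st₁, wit₁, hρ₁, hv₁, hal₁, hp₁, hq₁, hb₁⟩ :=
    exists_register_dual hwμ h₁.sum_le h₁.pos h₁.snd h₁.thd k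
  obtain ⟨W₂, X₂, Y₂, _, _, _, p₂, q₂, ρ₂, v₂, N₂, st₂, wit₂, hρ₂, hv₂, hal₂, hp₂, hq₂, hb₂⟩ :=
    exists_register_dual (fun b a c => hwμ a b c) h₂.sum_le h₂.pos h₂.snd h₂.thd k
  obtain ⟨W₃, X₃, Y₃, _, _, _, p₃, q₃, ρ₃, v₃, N₃, st₃, wit₃, hρ₃, hv₃, hal₃, hp₃, hq₃, hb₃⟩ :=
    exists_register_dual (fun c a b => hwμ a b c) h₃.sum_le h₃.pos h₃.snd h₃.thd k
  have hwv := norm_tripleKernel_le hwμ hρ₁ hρ₂ hρ₃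
  have hsum := sum_tripleKernel_le hμ h₁.sum_le (fun y ω => (norm_nonneg _).trans (hρ₂ y ω))
    (fun y ω => (norm_nonneg _).trans (hρ₃ y ω)) hv₁ hv₂ hv₃
  rcases bilinear_decay_or_phase 
    (fun x y => pushWeight (tripleMap p₁ p₂ p₃ q₁ q₂ q₃) (tripleKernel w ρ₁ ρ₂ ρ₃) (x, y))
    (fun x y => pushWeight (tripleMap p₁ p₂ p₃ q₁ q₂ q₃) (tripleKernel μ v₁ v₂ v₃) (x, y))
    (fun x y => norm_pushWeight_le _ hwv _)
    (by rw [← Fintype.sum_prod_type', sum_pushWeight]; exact hsum) with ⟨N, r, hr, h⟩ | ⟨α, hα, h⟩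
  -- The functions are replaced by dual functions in turn, each time with the earlier dual functions
  -- already in place; these are bounded by `1`, and the exponents multiply.
  · refine Or.inl ⟨N₁ * N₂ * N₃ * N, r, hr, fun n F G H hF hG hH => ?_⟩
    obtain ⟨f₁, g₁, hf₁, hg₁, hb₁⟩ := hb₁ n F G H hF hG hH
    have hD₁ := norm_dualFun_le n hρ₁ hv₁ p₁ q₁ hf₁ hg₁
    obtain ⟨f₂, g₂, hf₂, hg₂, hb₂⟩ := hb₂ n G _ H hG hD₁ hH
    have hD₂ := norm_dualFun_le n hρ₂ hv₂ p₂ q₂ hf₂ hg₂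
    obtain ⟨f₃, g₃, hf₃, hg₃, hb₃⟩ := hb₃ n H _ _ hH hD₁ hD₂
    rw [triSum_swap n w, triSum_swap n w] at hb₂
    rw [triSum_rotate n w, triSum_rotate n w, triSum_dualFun_push] at hb₃
    have h' := h n (fun x => f₁ (fun i => (x i).1) * f₂ (fun i => (x i).2.1) *
        f₃ (fun i => (x i).2.2))
      (fun y => g₁ (fun i => (y i).1) * g₂ (fun i => (y i).2.1) * g₃ (fun i => (y i).2.2))
      (fun x => by
        rw [norm_mul, norm_mul]
        exact mul_le_one₀ (mul_le_one₀ (hf₁ _) (norm_nonneg _) (hf₂ _)) (norm_nonneg _) (hf₃ _))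
      (fun x => by
        rw [norm_mul, norm_mul]
        exact mul_le_one₀ (mul_le_one₀ (hg₁ _) (norm_nonneg _) (hg₂ _)) (norm_nonneg _) (hg₃ _))
    rw [pow_mul, pow_mul, pow_mul]
    refine le_trans ?_ h'
    refine pow_le_pow_left₀ (pow_nonneg (pow_nonneg (pow_nonneg (norm_nonneg _) _) _) _) ?_ N
    refine le_trans ?_ hb₃
    refine pow_le_pow_left₀ (pow_nonneg (pow_nonneg (norm_nonneg _) _) _) ?_ N₃
    exact (pow_le_pow_left₀ (pow_nonneg (norm_nonneg _) _) hb₁ N₂).trans hb₂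
  · refine Or.inr ⟨fun bx bY bz => α (st₁ bx, st₂ bY, st₃ bz), fun _ _ _ => hα _, ?_⟩
    -- The reading kernels contribute phase `1`, so only the phase of `T` at the letters read
    -- remains.
    have key : ∀ bx bY bz i j l, 0 < μ (bx i) (bY j) (bz l) →
        Aligned (pushWeight (tripleMap p₁ p₂ p₃ q₁ q₂ q₃) (tripleKernel w ρ₁ ρ₂ ρ₃)
            ((st₁ bx, st₂ bY, st₃ bz), (q₁ (wit₁ bx i), q₂ (wit₂ bY j), q₃ (wit₃ bz l))))
          (pushWeight (tripleMap p₁ p₂ p₃ q₁ q₂ q₃) (tripleKernel μ v₁ v₂ v₃)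
            ((st₁ bx, st₂ bY, st₃ bz), (q₁ (wit₁ bx i), q₂ (wit₂ bY j), q₃ (wit₃ bz l))))
          (T (bx i) (bY j) (bz l)) := by
      intro bx bY bz i j l hpos
      have h7 := (aligned_tripleKernel hwμ hρ₁ hρ₂ hρ₃
        (ω := ((bx i, bY j, bz l), (wit₁ bx i, wit₂ bY j, wit₃ bz l))) (hwT _ _ _ hpos)
        (hal₁ bx i) (hal₂ bY j) (hal₃ bz l)).pushWeight (π := (tripleMap p₁ p₂ p₃ q₁ q₂ q₃)) hwv
      simp only [tripleMap, hp₁, hp₂, hp₃] at h7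
      exact h7
    intro bx bY bz i j l x y z hR hR'
    have h1 := key bx bY bz i j l hR
    have h2 := key (Function.update bx i x) (Function.update bY j y) (Function.update bz l z) i j l
      (by simpa using hR')
    -- The minus letters do not see the letters being replaced, so both entries lie in one column
    -- and their phases can be compared.
    rw [hq₁, hq₂, hq₃] at h2
    simp only [Function.update_self] at h2
    have h3 := h _ _ _ _ _ h1 h2
    have h8 : star (T x y z) * T x y z = 1 := by
      rw [← starRingEnd_apply, Complex.conj_mul', hT x y z hR']; simp
    have h9 : ∀ u, star (α u) * α u = 1 := fun u => by
      rw [← starRingEnd_apply, Complex.conj_mul', hα]; simp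
    have h10 := h9 (st₁ (Function.update bx i x), st₂ (Function.update bY j y),
      st₃ (Function.update bz l z))
    linear_combination (T x y z * α (st₁ (Function.update bx i x), st₂ (Function.update bY j y),
      st₃ (Function.update bz l z))) * h3 - (T (bx i) (bY j) (bz l) *
        α (st₁ (Function.update bx i x), st₂ (Function.update bY j y),
          st₃ (Function.update bz l z))) * h8 + (α (st₁ bx, st₂ bY, st₃ bz) * T x y z) * h10

end Relations

/-! ### Exponential rate and conclusion -/

theorem exists_rate_of_pow_le {N : ℕ} {r : ℝ} (hN : N ≠ 0) (hr0 : 0 ≤ r) (hr : r < 1) :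
    ∃ c : ℝ, 0 < c ∧ ∀ (n : ℕ) (x : ℝ), 0 ≤ x → x ^ N ≤ r ^ n → x ≤ (2 : ℝ) ^ (-(c * (n : ℝ))) := by
  -- The maximum keeps the logarithm meaningful when `r = 0`.
  set s := max r (1 / 2) with hs
  have hs0 : 0 < s := lt_max_of_lt_right (by norm_num)
  have hs1 : s < 1 := max_lt hr (by norm_num)
  have hN' : (0 : ℝ) < N := by exact_mod_cast Nat.pos_of_ne_zero hN
  refine ⟨-Real.logb 2 s / N, div_pos (neg_pos.2 (Real.logb_neg (by norm_num) hs0 hs1)) hN',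
    fun n x hx h => ?_⟩
  refine le_of_pow_le_pow_left₀ hN (by positivity) (h.trans ?_)
  calc r ^ n ≤ s ^ n := pow_le_pow_left₀ hr0 (le_max_left _ _) n
    _ = (2 : ℝ) ^ (Real.logb 2 s * n) := by
        rw [Real.rpow_mul (by norm_num), Real.rpow_logb (by norm_num) (by norm_num) hs0,
          Real.rpow_natCast]
    _ = _ := by
        rw [← Real.rpow_mul_natCast (by norm_num)]
        congr 1
        field_simp

theorem expectation_tensorPower_eq_triSum {S G P : Type*} [Fintype S] [Fintype G] [Fintype P]
    (μ : PMF (S × G × P)) (T : S × G × P → ℂ) (n : ℕ) (f : (Fin n → S) → ℂ) (g : (Fin n → G) → ℂ)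
    (h : (Fin n → P) → ℂ) :
    expectation (tensorPower μ n) (fun w =>
        f (fun i => (w i).1) * g (fun i => (w i).2.1) * h (fun i => (w i).2.2) * ∏ i, T (w i)) =
      triSum n (fun x y z => ((μ (x, y, z)).toReal : ℂ) * T (x, y, z)) f g h := by
  have h1 : ∀ w : Fin n → S × G × P,
      ((tensorPower μ n w).toReal : ℂ) = ∏ i, ((μ (w i)).toReal : ℂ) := by
    intro w
    simp [tensorPower, ENNReal.toReal_prod]
  simp only [expectation, h1]
  rw [sum_arrow_prod, triSum]
  refine Finset.sum_congr rfl fun x _ => ?_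
  rw [sum_arrow_prod]
  refine Finset.sum_congr rfl fun y _ => Finset.sum_congr rfl fun z _ => ?_
  rw [Finset.prod_mul_distrib]
  ring

theorem isLinked_of_connected {A B C : Type*} [Fintype A] [Fintype B] [Fintype C]
    [Nonempty B] [Nonempty C] {μ : A → B → C → ℝ} (hμ : ∀ a b c, 0 ≤ μ a b c)
    (hsum : ∑ a, ∑ b, ∑ c, μ a b c ≤ 1)
    (hsnd : (bipartiteGraph fun a b => ∃ c, 0 < μ a b c).Connected)
    (hthd : (bipartiteGraph fun a c => ∃ b, 0 < μ a b c).Connected) : IsLinked μ where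
  sum_le := hsum
  pos a := by
    obtain ⟨b, c, h⟩ := exists_of_bipartiteGraph_connected hsnd a
    exact Finset.sum_pos' (fun b _ => Finset.sum_nonneg fun c _ => hμ a b c)
      ⟨b, Finset.mem_univ b, Finset.sum_pos' (fun c _ => hμ a b c) ⟨c, Finset.mem_univ c, h⟩⟩
  snd := transGen_of_bipartiteGraph_connected hsnd
  thd := transGen_of_bipartiteGraph_connected hthd

/-- If the trilinear forms do not decay exponentially, then `T` is embeddable over the circle. -/
theorem exists_embedding_of_not_decay {A B C : Type*} [Fintype A] [Fintype B] [Fintype C]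
    [Nonempty A] [Nonempty B] [Nonempty C] {w : A → B → C → ℂ} {μ : A → B → C → ℝ}
    {T : A → B → C → ℂ} (h₁ : IsLinked μ) (h₂ : IsLinked fun b a c => μ a b c)
    (h₃ : IsLinked fun c a b => μ a b c) (hw : ∀ a b c, w a b c = μ a b c * T a b c)
    (hμ : ∀ a b c, 0 ≤ μ a b c) (hT : ∀ a b c, 0 < μ a b c → ‖T a b c‖ = 1)
    (hdecay : ¬ ∃ (N : ℕ) (r : ℝ), r < 1 ∧ ∀ (n : ℕ) (F : (Fin n → A) → ℂ) (G : (Fin n → B) → ℂ)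
      (H : (Fin n → C) → ℂ), (∀ a, ‖F a‖ ≤ 1) → (∀ b, ‖G b‖ ≤ 1) → (∀ c, ‖H c‖ ≤ 1) →
        ‖triSum n w F G H‖ ^ N ≤ r ^ n) :
    ∃ (f : A → Circle) (g : B → Circle) (h : C → Circle), ∀ a b c, 0 < μ a b c →
      (f a : ℂ) * g b * h c * T a b c = 1 := by
  classical
  let t : {e : A × B × C // 0 < μ e.1 e.2.1 e.2.2} → Circle := fun e =>
    ⟨T e.1.1 e.1.2.1 e.1.2.2, mem_sphere_zero_iff_norm.2 (hT _ _ _ e.2)⟩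
  obtain ⟨f, g, h, hfgh⟩ := exists_embedding_of_relations
    (fun e : {e : A × B × C // 0 < μ e.1 e.2.1 e.2.2} => e.1.1) (fun e => e.1.2.1)
    (fun e => e.1.2.2) t (prod_pow_eq_of_relations _ _ _ t fun k p q τ ρ hx hy hz => by
      obtain ⟨a, ha, hrep⟩ := (decay_or_replaces h₁ h₂ h₃ hw hμ hT k).resolve_left hdecay
      have h := hrep.prod_eq (fun x y z hR h0 => by simpa [h0] using hT x y z hR)
        (fun bx bY bz h0 => by simpa [h0] using ha bx bY bz) (fun i => (p i).2)
        (fun i => (q i).2) τ ρ hx hy hz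
      refine Circle.coe_injective ((map_prod Circle.coeHom _ _).trans (Eq.trans ?_
        (map_prod Circle.coeHom _ _).symm))
      exact h)
  exact ⟨f, g, h, fun a b c hR => congrArg Circle.coeHom (hfgh ⟨(a, b, c), hR⟩)⟩

theorem mainTheorem2 {S G P : Type*} [Fintype S] [Fintype G] [Fintype P]
    (μ : PMF (S × G × P)) (hμ : PairwiseConnected μ)
    (T : S × G × P → ℂ) (hT : ∀ p ∈ μ.support, ‖T p‖ ≤ 1) (hemb : Nonembeddable μ T) :
    ∃ c : ℝ, 0 < c ∧
      ∀ (n : ℕ) (f : (Fin n → S) → ℂ) (g : (Fin n → G) → ℂ) (h : (Fin n → P) → ℂ),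
        (∀ x, ‖f x‖ ≤ 1) → (∀ y, ‖g y‖ ≤ 1) → (∀ z, ‖h z‖ ≤ 1) →
        ‖expectation (tensorPower μ n) (fun w =>
            f (fun i => (w i).1) * g (fun i => (w i).2.1) * h (fun i => (w i).2.2) *
              ∏ i, T (w i))‖ ≤ (2 : ℝ) ^ (-(c * (n : ℝ))) := by
  classical
  simp only [expectation_tensorPower_eq_triSum]
  set w : S → G → P → ℂ := fun x y z => ((μ (x, y, z)).toReal : ℂ) * T (x, y, z) with hw
  suffices hdecay : ∃ (N : ℕ) (r : ℝ), r < 1 ∧ ∀ (n : ℕ) (f : (Fin n → S) → ℂ)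
      (g : (Fin n → G) → ℂ) (h : (Fin n → P) → ℂ), (∀ a, ‖f a‖ ≤ 1) → (∀ b, ‖g b‖ ≤ 1) →
        (∀ c, ‖h c‖ ≤ 1) → ‖triSum n w f g h‖ ^ N ≤ r ^ n by
    obtain ⟨N, r, hr, hdecay⟩ := hdecay
    -- Testing words of length one shows that `N ≠ 0`, since otherwise `1 ≤ r`, and that `0 ≤ r`.
    have h1 := hdecay 1 0 0 0 (by simp) (by simp) (by simp)
    have hN : N ≠ 0 := by
      rintro rfl
      simp only [pow_zero, pow_one] at h1
      linarith
    obtain ⟨c, hc, hrate⟩ := exists_rate_of_pow_le hN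
      ((pow_nonneg (norm_nonneg _) _).trans (h1.trans (pow_one r).le)) hr
    exact ⟨c, hc, fun n f g h hf hg hh => hrate n _ (norm_nonneg _) (hdecay n f g h hf hg hh)⟩
  have hpos : ∀ p, 0 < (μ p).toReal ↔ p ∈ μ.support := fun p => by
    rw [ENNReal.toReal_pos_iff, PMF.mem_support_iff, pos_iff_ne_zero]
    exact and_iff_left (μ.apply_lt_top p)
  have hsum : ∑ p, (μ p).toReal = 1 := by
    rw [← ENNReal.toReal_sum fun p _ => μ.apply_ne_top p, ← tsum_fintype (L := .unconditional _),
      μ.tsum_coe, ENNReal.toReal_one]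
  obtain ⟨⟨x₀, y₀, z₀⟩, -⟩ := μ.support_nonempty
  have : Nonempty S := ⟨x₀⟩
  have : Nonempty G := ⟨y₀⟩
  have : Nonempty P := ⟨z₀⟩
  by_cases hall : ∀ p ∈ μ.support, ‖T p‖ = 1
  · by_contra hdecay
    have hsum' : ∑ x, ∑ y, ∑ z, (μ (x, y, z)).toReal = 1 := by
      simpa only [Fintype.sum_prod_type] using hsum
    have h0 : ∀ x y z, 0 ≤ (μ (x, y, z)).toReal := fun _ _ _ => ENNReal.toReal_nonneg
    obtain ⟨hSG, hGP, hSP⟩ := hμ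
    simp only [← hpos] at hSG hGP hSP
    obtain ⟨A, B, C, hABC⟩ := exists_embedding_of_not_decay
      (μ := fun x y z => (μ (x, y, z)).toReal) (T := fun x y z => T (x, y, z))
      (isLinked_of_connected h0 hsum'.le hSG hSP)
      (isLinked_of_connected (fun y x z => h0 x y z) (by rw [Finset.sum_comm]; exact hsum'.le)
        (bipartiteGraph_flip_connected hSG) hGP)
      (isLinked_of_connected (fun z x y => h0 x y z) (by
          rw [Finset.sum_comm]
          simp only [Finset.sum_comm (s := (Finset.univ : Finset P))]
          exact hsum'.le)
        (bipartiteGraph_flip_connected hSP) (bipartiteGraph_flip_connected hGP))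
      (fun _ _ _ => rfl) h0 (fun x y z h => hall _ ((hpos _).1 h)) hdecay
    exact hemb ⟨fun x => A x, fun y => B y, fun z => C z, fun _ => (Circle.norm_coe _).le,
      fun _ => (Circle.norm_coe _).le, fun _ => (Circle.norm_coe _).le,
      fun x y z h => hABC x y z ((hpos _).2 h)⟩
  · push Not at hall
    obtain ⟨p, hp, hTp⟩ := hall
    -- If `|T| < 1` at a support triple, the weight itself has ℓ¹ norm below `1`, and the trivial
    -- bound suffices.
    refine ⟨1, ∑ p : S × G × P, ‖w p.1 p.2.1 p.2.2‖, ?_, fun n f g h hf hg hh => ?_⟩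
    · rw [← hsum]
      have hle : ∀ q, ‖w q.1 q.2.1 q.2.2‖ ≤ (μ q).toReal := fun q => by
        rw [hw, norm_mul, Complex.norm_real, Real.norm_of_nonneg ENNReal.toReal_nonneg]
        by_cases hq : q ∈ μ.support
        · exact mul_le_of_le_one_right ENNReal.toReal_nonneg (hT q hq)
        · simp [(PMF.apply_eq_zero_iff μ q).2 hq]
      refine Finset.sum_lt_sum (fun q _ => hle q) ⟨p, Finset.mem_univ p, ?_⟩
      rw [hw, norm_mul, Complex.norm_real, Real.norm_of_nonneg ENNReal.toReal_nonneg]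
      exact mul_lt_of_lt_one_right ((hpos p).2 hp) ((hT p hp).lt_of_ne hTp)
    · have h1 : triSum n w f g h = wordSum n (fun p : S × G × P => w p.1 p.2.1 p.2.2) (fun ω =>
          f (fun i => (ω i).1) * g (fun i => (ω i).2.1) * h (fun i => (ω i).2.2)) := by
        rw [wordSum, sum_arrow_prod, triSum]
        refine Finset.sum_congr rfl fun x _ => ?_
        rw [sum_arrow_prod]
      rw [pow_one, h1]
      refine norm_wordSum_le n _ _ fun ω => ?_
      rw [norm_mul, norm_mul]
      exact mul_le_one₀ (mul_le_one₀ (hf _) (norm_nonneg _) (hg _)) (norm_nonneg _) (hh _)
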